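/- **Setting.** Fix the countable set $\mathrm{Var}=\{x_0,x_1,\ldots\}$ of variables. Formulas are built with $\bot,\land,\lor,\to,\forall,\exists,=$, all primitive; $\neg A:=A\to\bot$. A *many-sorted signature* $\mathcal L$ consists of countable sets of relation symbols and of function symbols with arities $n\ge 0$; a nonempty countable set $\mathrm{Sort}$; pairwise disjoint infinite sets $\mathrm{Var}_i\subseteq\mathrm{Var}$ ($i\in\mathrm{Sort}$) of variables of sort $i$ (written $x^i$); for each $n$-ary relation symbol $R$ a nonempty set $\mathrm{rank}(R)\subseteq\mathrm{Sort}^n$; and for each $n$-ary function symbol $f$ a nonempty partial function $\mathrm{rank}(f)$ from $\mathrm{Sort}^n$ to $\mathrm{Sort}$. A variable $x^i$ is a well-sorted term of sort $i$; if $t_1,\dots,t_n$ are well-sorted terms of sorts $i_1,\dots,i_n$ and $\mathrm{rank}(f)(i_1,\dots,i_n)=i$, then $f(t_1,\dots,t_n)$ is a well-sorted term of sort $i$. *Well-sorted formulas* are built by the connectives and the quantifiers $\forall x^i,\exists x^i$ from $\bot$, equations $t_1=t_2$ between well-sorted terms of the same sort, and atoms $R(t_1,\dots,t_n)$ where the sorts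 of the well-sorted terms $t_1,\dots,t_n$ form a tuple in $\mathrm{rank}(R)$. An $\mathcal L$-sentence is a well-sorted formula without free variables. $\Pi\vdash_{\mathrm{FOL}}A$ means that $A$ is derivable from $\Pi$ in unsorted natural deduction (introduction and elimination rules for $\land,\lor,\to,\forall,\exists$, ex falso, and reductio ad absurdum, RAA), together with the universal closures of the axioms of reflexivity, symmetry and transitivity of $=$ and of congruence of $=$ for every relation and function symbol. $\Gamma\vdash^{\mathcal L}_{\mathrm{MSL}}\varphi$ means that $\varphi$ is derivable from $\Gamma$ by the same rules with only well-sorted formulas in the derivation, where a quantifier over $x^i$ is instantiated only by terms of sort $i$, and with the universal closures of the well-sorted instances of the equality axioms (a congruence axiom for $R$ or $f$ takes $x_k,y_k$ of the same sort $i_k$, with $(i_1,\dots,i_n)$ in $\mathrm{rank}(R)$, respectively in the domain of $\mathrm{rank}(f)$). The unsorted signature $\mathcal L^*$ has the symbols of $\mathcal L$ and a fresh unary relation symbol $Q_i$ for each $i\in\mathrm{Sort}$. The translation $\varphi\mapsto\varphi^*$ leaves atomic formulas unchanged, commutes with the connectives, and satisfies $(\forall x^i\varphi)^*=\forall x(Q_ix\to\varphi^*)$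 and $(\exists x^i\varphi)^*=\exists x(Q_ix\land\varphi^*)$; $\Gamma^*$ is the set of translations of the members of $\Gamma$. Let $J^+$ be the set of universal closures of the following formulas: - $\exists x\,Q_ix$ for $i\in\mathrm{Sort}$; - $Q_{i_1}x_1\land\dots\land Q_{i_n}x_n\to Q_i f(x_1,\dots,x_n)$ whenever $\mathrm{rank}(f)(i_1,\dots,i_n)=i$; - $Q_ix\to\neg Q_jx$ for $i\ne j$ in $\mathrm{Sort}$; - $R(x_1,\dots,x_n)\to Q_{i_k}x_k$ for $1\le k\le n$, whenever $R$ is strict, i.e. $\mathrm{rank}(R)$ is a singleton $\{(i_1,\dots,i_n)\}$; - if $\mathrm{Sort}$ is finite, $\bigvee_{i\in\mathrm{Sort}}Q_ix$. **Theorem.** If $\Gamma\cup\{\varphi\}$ is a set of $\mathcal L$-sentences, then $$\Gamma\vdash^{\mathcal L}_{\mathrm{MSL}}\varphi\quad\text{iff}\quad\Gamma^*,J^+\vdash_{\mathrm{FOL}}\varphi^*.$$ The same equivalence holds for intuitionistic logic, i.e. when RAA is removed from both calculi. -/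

import Mathlib

namespace ManySorted

universe u v w

/-- The two versions of the calculi: with and without the rule RAA. -/
inductive Logic : Type where
  | classical
  | intuitionistic

/-! ## Unsorted first-order formulas

Unsorted signatures are Mathlib's first-order languages, the variables are the natural numbers, and
terms are Mathlib's terms.  Formulas use named variables, and all of `⊥, ∧, ∨, →, ∀, ∃, =` are
primitive. -/

/-- The `L`-formulas. -/
inductive Formula (L : FirstOrder.Language.{u, v}) : Type (max u v) where
  | bot : Formula L
  | eq (t₁ t₂ : L.Term ℕ) : Formula L
  | rel {n : ℕ} (R : L.Relations n) (ts : Fin n → L.Term ℕ) : Formula L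
  | and (A B : Formula L) : Formula L
  | or (A B : Formula L) : Formula L
  | imp (A B : Formula L) : Formula L
  | all (x : ℕ) (A : Formula L) : Formula L
  | ex (x : ℕ) (A : Formula L) : Formula L

namespace Formula

variable {L : FirstOrder.Language.{u, v}}

/-- `¬ A` is `A → ⊥`. -/
def neg (A : Formula L) : Formula L := imp A bot

/-- `⊤` is `⊥ → ⊥`. -/
def top : Formula L := imp bot bot

/-- The finite conjunction `A₁ ∧ ... ∧ Aₙ` (which is `⊤` for `n = 0`). -/
def conj : List (Formula L) → Formula L
  | [] => top
  | [A] => A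
  | A :: B :: As => and A (conj (B :: As))

/-- The finite disjunction `A₁ ∨ ... ∨ Aₙ` (which is `⊥` for `n = 0`). -/
def disj : List (Formula L) → Formula L
  | [] => bot
  | [A] => A
  | A :: B :: As => or A (disj (B :: As))

/-- The free variables of a formula. -/
def freeVars : Formula L → Finset ℕ
  | bot => ∅
  | eq t₁ t₂ => t₁.varFinset ∪ t₂.varFinset
  | rel _ ts => Finset.univ.biUnion fun k => (ts k).varFinset
  | and A B => A.freeVars ∪ B.freeVars
  | or A B => A.freeVars ∪ B.freeVars
  | imp A B => A.freeVars ∪ B.freeVars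
  | all x A => A.freeVars.erase x
  | ex x A => A.freeVars.erase x

/-- The term `s[t/x]`. -/
def substTerm (x : ℕ) (t s : L.Term ℕ) : L.Term ℕ :=
  s.subst fun y => if y = x then t else FirstOrder.Language.Term.var y

/-- The formula `A[t/x]`: every free occurrence of `x` in `A` is replaced by `t`. -/
def subst (x : ℕ) (t : L.Term ℕ) : Formula L → Formula L
  | bot => bot
  | eq t₁ t₂ => eq (substTerm x t t₁) (substTerm x t t₂)
  | rel R ts => rel R fun k => substTerm x t (ts k)
  | and A B => and (A.subst x t) (B.subst x t)
  | or A B => or (A.subst x t) (B.subst x t)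
  | imp A B => imp (A.subst x t) (B.subst x t)
  | all y A => if y = x then all y A else all y (A.subst x t)
  | ex y A => if y = x then ex y A else ex y (A.subst x t)

/-- The term `t` is free for `x` in the formula: no free occurrence of `x` lies in the scope of a
quantifier that binds a variable of `t`. -/
def FreeFor (x : ℕ) (t : L.Term ℕ) : Formula L → Prop
  | bot => True
  | eq _ _ => True
  | rel _ _ => True
  | and A B => A.FreeFor x t ∧ B.FreeFor x t
  | or A B => A.FreeFor x t ∧ B.FreeFor x t
  | imp A B => A.FreeFor x t ∧ B.FreeFor x t
  | all y A => x ∉ (all y A).freeVars ∨ (y ∉ t.varFinset ∧ A.FreeFor x t)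
  | ex y A => x ∉ (ex y A).freeVars ∨ (y ∉ t.varFinset ∧ A.FreeFor x t)

/-- The universal closure of a formula (the variables are quantified in increasing order). -/
def closure (A : Formula L) : Formula L :=
  (A.freeVars.sort (· ≤ ·)).foldr all A

/-- The conjunction `x₁ = y₁ ∧ ... ∧ xₙ = yₙ`. -/
def eqs {n : ℕ} (x y : Fin n → ℕ) : Formula L :=
  conj (List.ofFn fun k => eq (FirstOrder.Language.Term.var (x k)) (FirstOrder.Language.Term.var (y k)))

end Formula

open Formula

/-! ## Natural deduction for unsorted first-order logic with equality -/

/-- The equality axioms of unsorted logic, before universal closure. -/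
inductive EqAxiom (L : FirstOrder.Language.{u, v}) : Formula L → Prop where
  | refl (x : ℕ) : EqAxiom L (eq (.var x) (.var x))
  | symm (x y : ℕ) : EqAxiom L (imp (eq (.var x) (.var y)) (eq (.var y) (.var x)))
  | trans (x y z : ℕ) : EqAxiom L
      (imp (and (eq (.var x) (.var y)) (eq (.var y) (.var z))) (eq (.var x) (.var z)))
  | rel {n : ℕ} (R : L.Relations n) (x y : Fin n → ℕ) : EqAxiom L
      (imp (eqs x y) (imp (rel R fun k => .var (x k)) (rel R fun k => .var (y k))))
  | func {n : ℕ} (f : L.Functions n) (x y : Fin n → ℕ) : EqAxiom L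
      (imp (eqs x y) (eq (.func f fun k => .var (x k)) (.func f fun k => .var (y k))))

/-- `FOL l Π A`: the formula `A` has a natural deduction derivation all of whose undischarged
assumptions are in `Π`.  The rule RAA is available only in classical logic. -/
inductive FOL {L : FirstOrder.Language.{u, v}} (l : Logic) : Set (Formula L) → Formula L → Prop where
  | assumption {P A} : A ∈ P → FOL l P A
  | weakening {P P' A} : P' ⊆ P → FOL l P' A → FOL l P A
  | eqAxiom {P A} : EqAxiom L A → FOL l P A.closure
  | andI {P A B} : FOL l P A → FOL l P B → FOL l P (and A B)
  | andE₁ {P A B} : FOL l P (and A B) → FOL l P A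
  | andE₂ {P A B} : FOL l P (and A B) → FOL l P B
  | orI₁ {P A B} : FOL l P A → FOL l P (or A B)
  | orI₂ {P A B} : FOL l P B → FOL l P (or A B)
  | orE {P A B C} : FOL l P (or A B) → FOL l (insert A P) C → FOL l (insert B P) C → FOL l P C
  | impI {P A B} : FOL l (insert A P) B → FOL l P (imp A B)
  | impE {P A B} : FOL l P (imp A B) → FOL l P A → FOL l P B
  | botE {P A} : FOL l P bot → FOL l P A
  | raa {P A} : l = Logic.classical → FOL l (insert (neg A) P) bot → FOL l P A
  | allI {P A} {x : ℕ} : (∀ B ∈ P, x ∉ B.freeVars) → FOL l P A → FOL l P (all x A)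
  | allE {P A} {x : ℕ} {t : L.Term ℕ} : A.FreeFor x t → FOL l P (all x A) → FOL l P (A.subst x t)
  | exI {P A} {x : ℕ} {t : L.Term ℕ} : A.FreeFor x t → FOL l P (A.subst x t) → FOL l P (ex x A)
  | exE {P P' A C} {x : ℕ} : P' ⊆ P → (∀ B ∈ P', x ∉ B.freeVars) → x ∉ C.freeVars →
      FOL l P (ex x A) → FOL l (insert A P') C → FOL l P C

/-! ## Many-sorted signatures and well-sorted formulas -/

/-- A many-sorted signature: a countable unsorted signature, a nonempty countable set of sorts,
pairwise disjoint infinite sets `{x | varSort x = some i}` of variables of sort `i` (there may be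
further variables, without a sort), and ranks: for a relation symbol a nonempty set of tuples of
sorts, for a function symbol a nonempty partial function from tuples of sorts to sorts. -/
structure Signature where
  lang : FirstOrder.Language.{u, v}
  countable_symbols : Countable lang.Symbols
  Sorts : Type w
  nonempty_sorts : Nonempty Sorts
  countable_sorts : Countable Sorts
  varSort : ℕ → Option Sorts
  infinite_vars : ∀ i, {x | varSort x = some i}.Infinite
  rankRel : ∀ {n : ℕ}, lang.Relations n → Set (Fin n → Sorts)
  rankRel_nonempty : ∀ {n : ℕ} (R : lang.Relations n), (rankRel R).Nonempty
  rankFun : ∀ {n : ℕ}, lang.Functions n → (Fin n → Sorts) → Option Sorts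
  rankFun_nonempty : ∀ {n : ℕ} (f : lang.Functions n), ∃ s i, rankFun f s = some i

namespace Signature

variable (S : Signature.{u, v, w})

/-- `S.HasSort t i`: the term `t` is well sorted, of sort `i`. -/
inductive HasSort : S.lang.Term ℕ → S.Sorts → Prop where
  | var {x : ℕ} {i : S.Sorts} : S.varSort x = some i → HasSort (.var x) i
  | func {n : ℕ} {f : S.lang.Functions n} {ts : Fin n → S.lang.Term ℕ} {s : Fin n → S.Sorts}
      {i : S.Sorts} : (∀ k, HasSort (ts k) (s k)) → S.rankFun f s = some i →
      HasSort (.func f ts) i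

/-- The well-sorted formulas. -/
inductive WellSorted : Formula S.lang → Prop where
  | bot : WellSorted bot
  | eq {t₁ t₂ : S.lang.Term ℕ} {i : S.Sorts} : S.HasSort t₁ i → S.HasSort t₂ i →
      WellSorted (eq t₁ t₂)
  | rel {n : ℕ} {R : S.lang.Relations n} {ts : Fin n → S.lang.Term ℕ} {s : Fin n → S.Sorts} :
      (∀ k, S.HasSort (ts k) (s k)) → s ∈ S.rankRel R → WellSorted (rel R ts)
  | and {φ ψ} : WellSorted φ → WellSorted ψ → WellSorted (and φ ψ)
  | or {φ ψ} : WellSorted φ → WellSorted ψ → WellSorted (or φ ψ)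
  | imp {φ ψ} : WellSorted φ → WellSorted ψ → WellSorted (imp φ ψ)
  | all {x : ℕ} {i : S.Sorts} {φ} : S.varSort x = some i → WellSorted φ → WellSorted (all x φ)
  | ex {x : ℕ} {i : S.Sorts} {φ} : S.varSort x = some i → WellSorted φ → WellSorted (ex x φ)

/-- The well-sorted sentences. -/
def IsSentence (φ : Formula S.lang) : Prop :=
  S.WellSorted φ ∧ φ.freeVars = ∅

/-! ## Natural deduction for many-sorted logic -/

/-- The equality axioms of many-sorted logic, before universal closure. -/
inductive MSEqAxiom : Formula S.lang → Prop where
  | refl {i : S.Sorts} {x : ℕ} : S.varSort x = some i → MSEqAxiom (eq (.var x) (.var x))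
  | symm {i : S.Sorts} {x y : ℕ} : S.varSort x = some i → S.varSort y = some i →
      MSEqAxiom (imp (eq (.var x) (.var y)) (eq (.var y) (.var x)))
  | trans {i : S.Sorts} {x y z : ℕ} : S.varSort x = some i → S.varSort y = some i →
      S.varSort z = some i → MSEqAxiom
        (imp (and (eq (.var x) (.var y)) (eq (.var y) (.var z))) (eq (.var x) (.var z)))
  | rel {n : ℕ} {R : S.lang.Relations n} {s : Fin n → S.Sorts} {x y : Fin n → ℕ} :
      s ∈ S.rankRel R → (∀ k, S.varSort (x k) = some (s k)) →
      (∀ k, S.varSort (y k) = some (s k)) → MSEqAxiom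
        (imp (eqs x y) (imp (rel R fun k => .var (x k)) (rel R fun k => .var (y k))))
  | func {n : ℕ} {f : S.lang.Functions n} {s : Fin n → S.Sorts} {i : S.Sorts}
      {x y : Fin n → ℕ} :
      S.rankFun f s = some i → (∀ k, S.varSort (x k) = some (s k)) →
      (∀ k, S.varSort (y k) = some (s k)) → MSEqAxiom
        (imp (eqs x y) (eq (.func f fun k => .var (x k)) (.func f fun k => .var (y k))))

/-- `S.MSL l Γ φ`: the formula `φ` has a many-sorted natural deduction derivation all of whose
undischarged assumptions are in `Γ`.  Only well-sorted formulas occur in a derivation, and a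
variable of sort `i` is instantiated by terms of sort `i` only.  The rule RAA is available only in
classical logic. -/
inductive MSL (l : Logic) : Set (Formula S.lang) → Formula S.lang → Prop where
  | assumption {Γ φ} : S.WellSorted φ → φ ∈ Γ → MSL l Γ φ
  | weakening {Γ Γ' φ} : Γ' ⊆ Γ → MSL l Γ' φ → MSL l Γ φ
  | eqAxiom {Γ φ} : S.MSEqAxiom φ → MSL l Γ φ.closure
  | andI {Γ φ ψ} : MSL l Γ φ → MSL l Γ ψ → MSL l Γ (and φ ψ)
  | andE₁ {Γ φ ψ} : MSL l Γ (and φ ψ) → MSL l Γ φ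
  | andE₂ {Γ φ ψ} : MSL l Γ (and φ ψ) → MSL l Γ ψ
  | orI₁ {Γ φ ψ} : S.WellSorted ψ → MSL l Γ φ → MSL l Γ (or φ ψ)
  | orI₂ {Γ φ ψ} : S.WellSorted φ → MSL l Γ ψ → MSL l Γ (or φ ψ)
  | orE {Γ φ ψ χ} : MSL l Γ (or φ ψ) → MSL l (insert φ Γ) χ → MSL l (insert ψ Γ) χ → MSL l Γ χ
  | impI {Γ φ ψ} : S.WellSorted φ → MSL l (insert φ Γ) ψ → MSL l Γ (imp φ ψ)
  | impE {Γ φ ψ} : MSL l Γ (imp φ ψ) → MSL l Γ φ → MSL l Γ ψ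
  | botE {Γ φ} : S.WellSorted φ → MSL l Γ bot → MSL l Γ φ
  | raa {Γ φ} : l = Logic.classical → S.WellSorted φ → MSL l (insert (neg φ) Γ) bot → MSL l Γ φ
  | allI {Γ φ} {x : ℕ} {i : S.Sorts} : S.varSort x = some i → (∀ ψ ∈ Γ, x ∉ ψ.freeVars) →
      MSL l Γ φ → MSL l Γ (all x φ)
  | allE {Γ φ} {x : ℕ} {i : S.Sorts} {t : S.lang.Term ℕ} : S.varSort x = some i →
      S.HasSort t i → φ.FreeFor x t → MSL l Γ (all x φ) → MSL l Γ (φ.subst x t)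
  | exI {Γ φ} {x : ℕ} {i : S.Sorts} {t : S.lang.Term ℕ} : S.varSort x = some i →
      S.HasSort t i → φ.FreeFor x t → S.WellSorted φ → MSL l Γ (φ.subst x t) → MSL l Γ (ex x φ)
  | exE {Γ Γ' φ ψ} {x : ℕ} : Γ' ⊆ Γ → (∀ χ ∈ Γ', x ∉ χ.freeVars) → x ∉ ψ.freeVars →
      MSL l Γ (ex x φ) → MSL l (insert φ Γ') ψ → MSL l Γ ψ

/-! ## The standard translation and the sort axioms -/

/-- The sort predicates: one unary relation symbol for each sort. -/
inductive SortPred : ℕ → Type w where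
  | Q (i : S.Sorts) : SortPred 1

/-- The target language: the symbols of `S` together with fresh unary sort predicates. -/
def starLang : FirstOrder.Language.{u, max v w} where
  Functions := S.lang.Functions
  Relations n := S.lang.Relations n ⊕ S.SortPred n

/-- The inclusion of the symbols of `S` in the target language. -/
def starHom : S.lang.LHom S.starLang where
  onFunction _ f := f
  onRelation _ R := Sum.inl R

/-- A term, read in the target language. -/
def starTerm (t : S.lang.Term ℕ) : S.starLang.Term ℕ :=
  S.starHom.onTerm t

/-- The atomic formula `Q_i t`. -/
def sortAtom (i : S.Sorts) (t : S.starLang.Term ℕ) : Formula S.starLang :=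
  Formula.rel (L := S.starLang) (n := 1) (Sum.inr (SortPred.Q i)) fun _ => t

/-- The translation: quantifiers over a variable of sort `i` are relativized to `Q_i`.  (The value
at a quantifier over a variable without a sort is irrelevant: well-sorted formulas have none.) -/
def star : Formula S.lang → Formula S.starLang
  | .bot => .bot
  | .eq t₁ t₂ => .eq (S.starTerm t₁) (S.starTerm t₂)
  | .rel (n := n) R ts =>
      Formula.rel (L := S.starLang) (n := n) (Sum.inl R) fun k => S.starTerm (ts k)
  | .and φ ψ => .and (star φ) (star ψ)
  | .or φ ψ => .or (star φ) (star ψ)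
  | .imp φ ψ => .imp (star φ) (star ψ)
  | .all x φ =>
      match S.varSort x with
      | some i => .all x (.imp (S.sortAtom i (.var x)) (star φ))
      | none => .all x (star φ)
  | .ex x φ =>
      match S.varSort x with
      | some i => .ex x (.and (S.sortAtom i (.var x)) (star φ))
      | none => .ex x (star φ)

/-- The basic sort axioms, before universal closure. -/
inductive SortAxiom : Formula S.starLang → Prop where
  | nonempty (i : S.Sorts) (x : ℕ) : SortAxiom (ex x (S.sortAtom i (.var x)))
  | func {n : ℕ} (f : S.lang.Functions n) (s : Fin n → S.Sorts) (i : S.Sorts) (x : Fin n → ℕ) :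
      S.rankFun f s = some i → SortAxiom
        (imp (conj (List.ofFn fun k => S.sortAtom (s k) (.var (x k))))
          (S.sortAtom i (S.starTerm (.func f fun k => .var (x k)))))

/-- The optional sort axioms, before universal closure: distinct sorts are disjoint; a strict
relation symbol, that is, one whose rank is a singleton, forces the sorts of its arguments; and, if
there are only finitely many sorts, every element has a sort.  In `cover`, the list `is` enumerates
all sorts without repetition; such a list exists if and only if there are finitely many sorts. -/
inductive OptionalSortAxiom : Formula S.starLang → Prop where
  | disjoint (i j : S.Sorts) (x : ℕ) : i ≠ j →
      OptionalSortAxiom (imp (S.sortAtom i (.var x)) (neg (S.sortAtom j (.var x))))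
  | strict {n : ℕ} (R : S.lang.Relations n) (s : Fin n → S.Sorts) (x : Fin n → ℕ) (k : Fin n) :
      S.rankRel R = {s} → OptionalSortAxiom
        (imp (S.star (rel R fun k => .var (x k))) (S.sortAtom (s k) (.var (x k))))
  | cover (is : List S.Sorts) (x : ℕ) : is.Nodup → (∀ i, i ∈ is) →
      OptionalSortAxiom (disj (is.map fun i => S.sortAtom i (.var x)))

/-- The set `J` of sort axioms. -/
def J : Set (Formula S.starLang) :=
  {A | ∃ B, S.SortAxiom B ∧ A = B.closure}

/-- The extended set `J⁺` of sort axioms. -/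
def JPlus : Set (Formula S.starLang) :=
  S.J ∪ {A | ∃ B, S.OptionalSortAxiom B ∧ A = B.closure}

end Signature

end ManySorted

namespace ManySorted

universe u v w

open Formula
open FirstOrder.Language

namespace Formula

variable {L : FirstOrder.Language.{u, v}}

/-! ## Substitution in terms -/

/-! Soundness. A many-sorted derivation of `φ` is translated rule by rule. A variable of sort `i`
silently carries the information `Q_i x`, so the unsorted derivation gets the extra hypotheses `Q_i
x` for all sorted `x` in a finite set `V`; this is `sortContext`. Derivations may pass through
variables that occur in neither premises nor conclusion, hence `MSL.eventually_star` claims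
derivability for all sufficiently large `V`. The function axioms in `J` give the sorts of terms
(`HasSort.derivable`), which is what the guards `Q_i` demand when a quantifier is instantiated. For
sentences the extra hypotheses are then eliminated one at a time with the axioms `∃ x, Q_i x`
(`fol_of_sortContext`). Only `J` is needed here.

Faithfulness. Given `Γ`, one model refutes everything that `Γ` does not prove, uniformly for both
logics. Its truth values form the Dedekind-MacNeille completion of the well-sorted formulas
preordered by derivability from `Γ`. This completion is a frame, because the preorder has
implications (`inf_sSup_le_iSup_inf`), and with RAA its double negation is trivial
(`compl_compl_le`). The domain consists of the well-sorted terms. An equation or atom has itself as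
value if it is well sorted and `⊥` otherwise, while `Q_i` takes only the values `⊤` and `⊥` and
holds of the terms of sort `i`. Every axiom of `J⁺` then has value `⊤`, since sorts of terms are
unique and every element has one (`val_sortAxiom`, `val_optionalSortAxiom`).

The truth lemma `val_star` says that under the identical valuation `φ*` has the principal cut of `φ`
as its value. The quantifiers are the crux: guards cut the range down to terms of the right sort,
and an instance at a fresh variable makes `∀ x φ` the infimum, and `∃ x φ` the supremum, of the
instances. Soundness of unsorted logic in Heyting-valued models (`HeytingModel.sound`) now turns a
proof of `φ*` from `Γ*` and `J⁺` into the statement that the cut of `φ` is `⊤`, that is, `Γ` proves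
`φ`. -/

@[simp]
theorem substTerm_var (x y : ℕ) (t : L.Term ℕ) :
    substTerm x t (.var y) = if y = x then t else .var y := rfl

@[simp]
theorem substTerm_func (x : ℕ) (t : L.Term ℕ) {n : ℕ} (f : L.Functions n)
    (ts : Fin n → L.Term ℕ) :
    substTerm x t (.func f ts) = .func f fun k => substTerm x t (ts k) := rfl

theorem mem_varFinset_func {y n : ℕ} {f : L.Functions n} {ts : Fin n → L.Term ℕ} :
    y ∈ (Term.func f ts).varFinset ↔ ∃ k, y ∈ (ts k).varFinset := by
  simp [Term.varFinset]

@[simp]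
theorem mem_varFinset_var {x y : ℕ} : y ∈ (Term.var x : L.Term ℕ).varFinset ↔ y = x := by
  simp [Term.varFinset]

theorem subst_congr {s : L.Term ℕ} {σ τ : ℕ → L.Term ℕ} (h : ∀ x ∈ s.varFinset, σ x = τ x) :
    s.subst σ = s.subst τ := by
  induction s with
  | var x => exact h x (by simp)
  | func f ts ih =>
    simp only [Term.subst]
    congr 1; funext k
    exact ih k fun x hx => h x (mem_varFinset_func.2 ⟨k, hx⟩)

@[simp]
theorem subst_var (s : L.Term ℕ) : s.subst Term.var = s := by
  induction s with
  | var x => rfl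
  | func f ts ih => simp only [Term.subst]; congr 1; funext k; exact ih k

theorem substTerm_of_notMem {x : ℕ} {t s : L.Term ℕ} (h : x ∉ s.varFinset) :
    substTerm x t s = s := by
  conv_rhs => rw [← subst_var s]
  refine subst_congr fun y hy => if_neg ?_
  rintro rfl; exact h hy

@[simp]
theorem substTerm_self (x : ℕ) (s : L.Term ℕ) : substTerm x (.var x) s = s := by
  conv_rhs => rw [← subst_var s]
  refine subst_congr fun y _ => ?_
  split_ifs with h
  · rw [h]
  · rfl

theorem mem_varFinset_substTerm {x y : ℕ} {t s : L.Term ℕ}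
    (h : y ∈ (substTerm x t s).varFinset) :
    (y ≠ x ∧ y ∈ s.varFinset) ∨ y ∈ t.varFinset := by
  induction s with
  | var z =>
    rw [substTerm_var] at h
    split_ifs at h with hz
    · exact .inr h
    · rw [mem_varFinset_var] at h
      subst h
      exact .inl ⟨hz, by simp⟩
  | func f ts ih =>
    obtain ⟨k, hk⟩ := mem_varFinset_func.1 h
    exact (ih k hk).imp_left fun h => ⟨h.1, mem_varFinset_func.2 ⟨k, h.2⟩⟩

theorem substTerm_back {x y : ℕ} {s : L.Term ℕ} (h : y ∉ s.varFinset) :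
    substTerm y (.var x) (substTerm x (.var y) s) = s := by
  induction s with
  | var z =>
    have hz : y ≠ z := by simpa using h
    rw [substTerm_var]
    split_ifs with hzx
    · simp [hzx]
    · simp [hz.symm]
  | func f ts ih =>
    simp only [substTerm_func]
    congr 1; funext k
    exact ih k fun hk => h (mem_varFinset_func.2 ⟨k, hk⟩)

theorem subst_substTerm (x : ℕ) (t s : L.Term ℕ) (σ : ℕ → L.Term ℕ) :
    (substTerm x t s).subst σ = s.subst (Function.update σ x (t.subst σ)) := by
  induction s with
  | var z =>
    rw [substTerm_var]
    split_ifs with h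
    · simp [h]
    · simp [Function.update_of_ne h]
  | func f ts ih => simp only [substTerm_func, Term.subst]; congr 1; funext k; exact ih k

/-! ## Substitution in formulas -/

theorem mem_freeVars_rel {y n : ℕ} {R : L.Relations n} {ts : Fin n → L.Term ℕ} :
    y ∈ (rel R ts).freeVars ↔ ∃ k, y ∈ (ts k).varFinset := by
  simp [freeVars]

/-- The bound variables of a formula. -/
def boundVars : Formula L → Finset ℕ
  | bot => ∅
  | eq _ _ => ∅
  | rel _ _ => ∅
  | and A B => A.boundVars ∪ B.boundVars
  | or A B => A.boundVars ∪ B.boundVars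
  | imp A B => A.boundVars ∪ B.boundVars
  | all x A => insert x A.boundVars
  | ex x A => insert x A.boundVars

/-- The number of connectives and quantifiers of a formula. -/
def size : Formula L → ℕ
  | bot => 0
  | eq _ _ => 0
  | rel _ _ => 0
  | and A B => A.size + B.size + 1
  | or A B => A.size + B.size + 1
  | imp A B => A.size + B.size + 1
  | all _ A => A.size + 1
  | ex _ A => A.size + 1

@[simp]
theorem boundVars_subst (x : ℕ) (t : L.Term ℕ) (A : Formula L) :
    (A.subst x t).boundVars = A.boundVars := by
  induction A with
  | bot | eq | rel => rfl
  | and A B ihA ihB | or A B ihA ihB | imp A B ihA ihB => simp [subst, boundVars, ihA, ihB]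
  | all y A ih | ex y A ih => simp only [subst]; split_ifs <;> simp [boundVars, ih]

@[simp]
theorem size_subst (x : ℕ) (t : L.Term ℕ) (A : Formula L) : (A.subst x t).size = A.size := by
  induction A with
  | bot | eq | rel => rfl
  | and A B ihA ihB | or A B ihA ihB | imp A B ihA ihB => simp [subst, size, ihA, ihB]
  | all y A ih | ex y A ih => simp only [subst]; split_ifs <;> simp [size, ih]

theorem subst_of_notMem {x : ℕ} {t : L.Term ℕ} {A : Formula L} (h : x ∉ A.freeVars) :
    A.subst x t = A := by
  induction A with
  | bot => rfl
  | eq t₁ t₂ =>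
    simp only [freeVars, Finset.mem_union, not_or] at h
    simp [subst, substTerm_of_notMem h.1, substTerm_of_notMem h.2]
  | rel R ts =>
    simp only [mem_freeVars_rel, not_exists] at h
    simp [subst, substTerm_of_notMem (h _)]
  | and A B ihA ihB | or A B ihA ihB | imp A B ihA ihB =>
    simp only [freeVars, Finset.mem_union, not_or] at h
    simp [subst, ihA h.1, ihB h.2]
  | all y A ih | ex y A ih =>
    simp only [subst]
    split_ifs with hy
    · rfl
    · rw [ih]
      intro hA
      exact h (by simp [freeVars, hA, Ne.symm hy])

@[simp]
theorem subst_self (x : ℕ) (A : Formula L) : A.subst x (.var x) = A := by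
  induction A with
  | bot => rfl
  | eq | rel => simp [subst]
  | and A B ihA ihB | or A B ihA ihB | imp A B ihA ihB => simp [subst, ihA, ihB]
  | all y A ih | ex y A ih => simp [subst, ih]

theorem freeFor_of_notMem {x : ℕ} {t : L.Term ℕ} {A : Formula L} (h : x ∉ A.freeVars) :
    A.FreeFor x t := by
  induction A with
  | bot | eq | rel => trivial
  | and A B ihA ihB | or A B ihA ihB | imp A B ihA ihB =>
    simp only [freeVars, Finset.mem_union, not_or] at h
    exact ⟨ihA h.1, ihB h.2⟩
  | all y A ih | ex y A ih => exact .inl h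

theorem freeFor_of_disjoint {x : ℕ} {t : L.Term ℕ} {A : Formula L}
    (h : Disjoint A.boundVars t.varFinset) : A.FreeFor x t := by
  induction A with
  | bot | eq | rel => trivial
  | and A B ihA ihB | or A B ihA ihB | imp A B ihA ihB =>
    simp only [boundVars, Finset.disjoint_union_left] at h
    exact ⟨ihA h.1, ihB h.2⟩
  | all y A ih | ex y A ih =>
    simp only [boundVars, Finset.disjoint_insert_left] at h
    exact .inr ⟨h.1, ih h.2⟩

theorem freeFor_self (x : ℕ) (A : Formula L) : A.FreeFor x (.var x) := by
  induction A with
  | bot | eq | rel => trivial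
  | and A B ihA ihB | or A B ihA ihB | imp A B ihA ihB => exact ⟨ihA, ihB⟩
  | all y A ih | ex y A ih =>
    by_cases h : y = x
    · exact .inl (by simp [freeVars, h])
    · exact .inr ⟨by simpa using h, ih⟩

theorem mem_freeVars_subst {x y : ℕ} {t : L.Term ℕ} {A : Formula L}
    (h : y ∈ (A.subst x t).freeVars) : (y ≠ x ∧ y ∈ A.freeVars) ∨ y ∈ t.varFinset := by
  induction A with
  | bot => simp [subst, freeVars] at h
  | eq t₁ t₂ =>
    simp only [subst, freeVars, Finset.mem_union] at h ⊢
    rcases h with h | h <;> have := mem_varFinset_substTerm h <;> tauto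
  | rel R ts =>
    simp only [subst, mem_freeVars_rel] at h ⊢
    obtain ⟨k, hk⟩ := h
    exact (mem_varFinset_substTerm hk).imp_left fun h => ⟨h.1, k, h.2⟩
  | and A B ihA ihB | or A B ihA ihB | imp A B ihA ihB =>
    simp only [subst, freeVars, Finset.mem_union] at h ⊢
    tauto
  | all z A ih | ex z A ih =>
    simp only [subst] at h
    split_ifs at h with hz
    · simp only [freeVars, Finset.mem_erase] at h ⊢
      subst hz
      exact .inl ⟨h.1, h⟩
    · simp only [freeVars, Finset.mem_erase] at h ⊢
      have := ih h.2
      tauto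

/-- Since `y` is new to `A`, its occurrences after the substitution are exactly the former free
occurrences of `x`. This makes renaming a bound variable reversible. -/
theorem subst_back {x y : ℕ} {A : Formula L} (hf : y ∉ A.freeVars) (hb : y ∉ A.boundVars) :
    (A.subst x (.var y)).subst y (.var x) = A := by
  induction A with
  | bot => rfl
  | eq t₁ t₂ =>
    simp only [freeVars, Finset.mem_union, not_or] at hf
    simp [subst, substTerm_back hf.1, substTerm_back hf.2]
  | rel R ts =>
    simp only [mem_freeVars_rel, not_exists] at hf
    simp [subst, substTerm_back (hf _)]
  | and A B ihA ihB | or A B ihA ihB | imp A B ihA ihB =>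
    simp only [freeVars, boundVars, Finset.mem_union, not_or] at hf hb
    simp [subst, ihA hf.1 hb.1, ihB hf.2 hb.2]
  | all z A ih | ex z A ih =>
    have hb' := hb
    simp only [boundVars, Finset.mem_insert, not_or] at hb'
    by_cases hz : z = x
    · simp only [subst, hz, if_true]
      rw [← hz, ← subst, subst_of_notMem hf]
    · have hf' : y ∉ A.freeVars := by
        intro h; exact hf (by simp [freeVars, h, hb'.1])
      simp [subst, hz, Ne.symm hb'.1, ih hf' hb'.2]

theorem freeFor_back {x y : ℕ} {A : Formula L} (hf : y ∉ A.freeVars) (hb : y ∉ A.boundVars) :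
    (A.subst x (.var y)).FreeFor y (.var x) := by
  induction A with
  | bot | eq | rel => trivial
  | and A B ihA ihB | or A B ihA ihB | imp A B ihA ihB =>
    simp only [freeVars, boundVars, Finset.mem_union, not_or] at hf hb
    exact ⟨ihA hf.1 hb.1, ihB hf.2 hb.2⟩
  | all z A ih | ex z A ih =>
    have hb' := hb
    simp only [boundVars, Finset.mem_insert, not_or] at hb'
    by_cases hz : z = x
    · simp only [subst, hz, if_true]
      exact .inl (by rwa [← hz])
    · have hf' : y ∉ A.freeVars := by
        intro h; exact hf (by simp [freeVars, h, hb'.1])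
      simp only [subst, hz, if_false]
      exact .inr ⟨by simpa using hz, ih hf' hb'.2⟩

theorem freeFor_var {x y : ℕ} {A : Formula L} (hb : y ∉ A.boundVars) :
    A.FreeFor x (.var y) :=
  freeFor_of_disjoint <| by simpa [Term.varFinset] using hb

/-! ## Universal closures -/

theorem freeVars_foldr_all (l : List ℕ) (A : Formula L) :
    (l.foldr all A).freeVars = A.freeVars \ l.toFinset := by
  induction l with
  | nil => simp
  | cons x l ih =>
    ext y
    simp only [List.foldr_cons, freeVars, ih, Finset.mem_erase, Finset.mem_sdiff,
      List.toFinset_cons, Finset.mem_insert, not_or]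
    tauto

@[simp]
theorem freeVars_closure (A : Formula L) : A.closure.freeVars = ∅ := by
  simp [closure, freeVars_foldr_all]

theorem closure_of_freeVars_eq_empty {A : Formula L} (h : A.freeVars = ∅) : A.closure = A := by
  simp [closure, h]

theorem subst_foldr_all {x : ℕ} {t : L.Term ℕ} {l : List ℕ} (hx : x ∉ l) (A : Formula L) :
    (l.foldr all A).subst x t = l.foldr all (A.subst x t) := by
  induction l with
  | nil => rfl
  | cons y l ih =>
    simp only [List.mem_cons, not_or] at hx
    simp [subst, Ne.symm hx.1, ih hx.2]

theorem boundVars_foldr_all (l : List ℕ) (A : Formula L) :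
    (l.foldr all A).boundVars = l.toFinset ∪ A.boundVars := by
  induction l with
  | nil => simp
  | cons x l ih => simp [boundVars, ih]

/-- Simultaneous substitution, meant for quantifier-free formulas. -/
def substAll (σ : ℕ → L.Term ℕ) : Formula L → Formula L
  | bot => bot
  | eq t₁ t₂ => eq (t₁.subst σ) (t₂.subst σ)
  | rel R ts => rel R fun k => (ts k).subst σ
  | and A B => and (A.substAll σ) (B.substAll σ)
  | or A B => or (A.substAll σ) (B.substAll σ)
  | imp A B => imp (A.substAll σ) (B.substAll σ)
  | all x A => all x A
  | ex x A => ex x A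

/-- Formulas without quantifiers. -/
def QuantifierFree : Formula L → Prop
  | bot => True
  | eq _ _ => True
  | rel _ _ => True
  | and A B => A.QuantifierFree ∧ B.QuantifierFree
  | or A B => A.QuantifierFree ∧ B.QuantifierFree
  | imp A B => A.QuantifierFree ∧ B.QuantifierFree
  | all _ _ => False
  | ex _ _ => False

theorem QuantifierFree.boundVars_eq {A : Formula L} (h : A.QuantifierFree) :
    A.boundVars = ∅ := by
  induction A with
  | bot | eq | rel => rfl
  | and A B ihA ihB | or A B ihA ihB | imp A B ihA ihB =>
    simp [boundVars, ihA h.1, ihB h.2]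
  | all | ex => exact h.elim

theorem QuantifierFree.subst {A : Formula L} (h : A.QuantifierFree) (x : ℕ) (t : L.Term ℕ) :
    (A.subst x t).QuantifierFree := by
  induction A with
  | bot | eq | rel => trivial
  | and A B ihA ihB | or A B ihA ihB | imp A B ihA ihB => exact ⟨ihA h.1, ihB h.2⟩
  | all | ex => exact h.elim

theorem QuantifierFree.substAll_subst {A : Formula L} (h : A.QuantifierFree) (x : ℕ)
    (t : L.Term ℕ) (σ : ℕ → L.Term ℕ) :
    (A.subst x t).substAll σ = A.substAll (Function.update σ x (t.subst σ)) := by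
  induction A with
  | bot => rfl
  | eq | rel => simp [Formula.subst, substAll, subst_substTerm]
  | and A B ihA ihB | or A B ihA ihB | imp A B ihA ihB =>
    simp [Formula.subst, substAll, ihA h.1, ihB h.2]
  | all | ex => exact h.elim

theorem substAll_congr {A : Formula L} {σ τ : ℕ → L.Term ℕ} (h : ∀ x ∈ A.freeVars, σ x = τ x) :
    A.substAll σ = A.substAll τ := by
  induction A with
  | bot | all | ex => rfl
  | eq t₁ t₂ =>
    simp only [freeVars, Finset.mem_union] at h
    simp only [substAll]
    rw [subst_congr fun x hx => h x (.inl hx), subst_congr fun x hx => h x (.inr hx)]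
  | rel R ts =>
    simp only [substAll]
    congr 1; funext k
    exact subst_congr fun x hx => h x (mem_freeVars_rel.2 ⟨k, hx⟩)
  | and A B ihA ihB | or A B ihA ihB | imp A B ihA ihB =>
    simp only [freeVars, Finset.mem_union] at h
    simp only [substAll]
    rw [ihA fun x hx => h x (.inl hx), ihB fun x hx => h x (.inr hx)]

@[simp]
theorem substAll_var (A : Formula L) : A.substAll Term.var = A := by
  induction A with
  | bot | all | ex => rfl
  | eq | rel => simp [substAll]
  | and A B ihA ihB | or A B ihA ihB | imp A B ihA ihB => simp [substAll, ihA, ihB]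

/-- A provability predicate that is closed under universal instantiation by admissible terms
is closed under simultaneous instantiation of universal prefixes, provided that no variable of the
prefix occurs in the terms. -/
theorem instantiate_foldr {Prov : Formula L → Prop} {ok : ℕ → L.Term ℕ → Prop}
    (hall : ∀ {A x t}, ok x t → A.FreeFor x t → Prov (all x A) → Prov (A.subst x t))
    {σ : ℕ → L.Term ℕ} {l : List ℕ} (hl : l.Nodup) (hok : ∀ x ∈ l, ok x (σ x))
    (hσ : ∀ x ∈ l, ∀ y ∈ l, y ∉ (σ x).varFinset) {A : Formula L} (hA : A.QuantifierFree)
    (h : Prov (l.foldr all A)) :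
    Prov (A.substAll fun x => if x ∈ l then σ x else .var x) := by
  induction l generalizing A with
  | nil => simpa using h
  | cons x l ih =>
    simp only [List.nodup_cons] at hl
    simp only [List.foldr_cons] at h
    have hx := hσ x (by simp)
    have hfree : (l.foldr all A).FreeFor x (σ x) := by
      refine freeFor_of_disjoint ?_
      rw [boundVars_foldr_all, hA.boundVars_eq, Finset.union_empty, Finset.disjoint_left]
      intro y hy
      exact hx y (by simp at hy; simp [hy])
    have h1 := hall (hok x (by simp)) hfree h
    rw [subst_foldr_all hl.1] at h1
    have h2 := ih hl.2 (fun y hy => hok y (by simp [hy]))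
      (fun y hy z hz => hσ y (by simp [hy]) z (by simp [hz])) (hA.subst x _) h1
    rw [hA.substAll_subst] at h2
    -- Instantiating `x` first and the other prefix variables afterwards is simultaneous
    -- instantiation, because `σ x` contains no prefix variable and is left alone by the later
    -- substitutions.
    convert h2 using 2
    funext y
    by_cases hy : y = x
    · subst hy
      simp only [List.mem_cons, true_or, if_true, Function.update_self]
      conv_lhs => rw [← subst_var (σ y)]
      refine subst_congr fun z hz => ?_
      rw [if_neg fun hzl => hx z (by simp [hzl]) hz]
    · simp [hy]

/-- Provability is kept abstract so that the same argument serves both calculi; `ok` records the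
sort restriction on instantiation, which is vacuous in the unsorted case. -/
theorem instantiate_closure {Prov : Formula L → Prop} {ok : ℕ → L.Term ℕ → Prop}
    (hall : ∀ {A x t}, ok x t → A.FreeFor x t → Prov (all x A) → Prov (A.subst x t))
    {σ : ℕ → L.Term ℕ} {A : Formula L} (hA : A.QuantifierFree)
    (hok : ∀ x ∈ A.freeVars, ok x (σ x))
    (hσ : ∀ x ∈ A.freeVars, ∀ y ∈ A.freeVars, y ∉ (σ x).varFinset)
    (h : Prov A.closure) : Prov (A.substAll σ) := by
  have h1 := instantiate_foldr (ok := ok) hall (Finset.sort_nodup _ _) (by simpa using hok)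
    (by simpa using hσ) hA h
  rwa [substAll_congr (τ := σ) fun x hx => by simp [hx]] at h1

/-- Removal of a universal prefix. -/
theorem instantiate_self {Prov : Formula L → Prop} {ok : ℕ → Prop}
    (hall : ∀ {A x}, ok x → Prov (all x A) → Prov A) {l : List ℕ} (hok : ∀ x ∈ l, ok x)
    {A : Formula L} (h : Prov (l.foldr all A)) : Prov A := by
  induction l with
  | nil => exact h
  | cons x l ih => exact ih (fun y hy => hok y (by simp [hy])) (hall (hok x (by simp)) h)

theorem quantifierFree_conj {As : List (Formula L)} (h : ∀ A ∈ As, A.QuantifierFree) :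
    (conj As).QuantifierFree := by
  induction As using conj.induct with
  | case1 => exact ⟨trivial, trivial⟩
  | case2 A => simpa [conj] using h
  | case3 A B As ih =>
    exact ⟨h A (by simp), ih fun C hC => h C (by simp [List.mem_cons.1 hC])⟩

theorem mem_freeVars_conj {As : List (Formula L)} {x : ℕ} :
    x ∈ (conj As).freeVars ↔ ∃ A ∈ As, x ∈ A.freeVars := by
  induction As using conj.induct with
  | case1 => simp [conj, top, freeVars]
  | case2 A => simp [conj]
  | case3 A B As ih => simp [conj, freeVars, ih]

theorem substAll_conj (σ : ℕ → L.Term ℕ) (As : List (Formula L)) :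
    (conj As).substAll σ = conj (As.map (substAll σ)) := by
  induction As using conj.induct with
  | case1 => rfl
  | case2 A => simp [conj]
  | case3 A B As ih => simpa [conj, substAll] using ih

end Formula

/-! ## Heyting-valued models of unsorted logic -/

/-- A model of the `L`-formulas with truth values in a complete Heyting algebra `H` and with
domain `D`. -/
structure HeytingModel (L : FirstOrder.Language.{u, v}) (H D : Type*) [Order.Frame H] where
  /-- The interpretation of the function symbols. -/
  func : ∀ {n : ℕ}, L.Functions n → (Fin n → D) → D
  /-- The interpretation of the relation symbols. -/
  rel : ∀ {n : ℕ}, L.Relations n → (Fin n → D) → H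
  /-- The interpretation of equality. -/
  eq : D → D → H
  eq_refl : ∀ a, eq a a = ⊤
  eq_symm : ∀ a b, eq a b ≤ eq b a
  eq_trans : ∀ a b c, eq a b ⊓ eq b c ≤ eq a c
  func_congr : ∀ {n : ℕ} (f : L.Functions n) (a b : Fin n → D),
    ⨅ k, eq (a k) (b k) ≤ eq (func f a) (func f b)
  rel_congr : ∀ {n : ℕ} (R : L.Relations n) (a b : Fin n → D),
    (⨅ k, eq (a k) (b k)) ⊓ rel R a ≤ rel R b

namespace HeytingModel

variable {L : FirstOrder.Language.{u, v}} {H D : Type*} [Order.Frame H] (M : HeytingModel L H D)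

/-- The value of a term. -/
def term (ρ : ℕ → D) : L.Term ℕ → D
  | .var x => ρ x
  | .func f ts => M.func f fun k => term ρ (ts k)

/-- The truth value of a formula. -/
def val : (ℕ → D) → Formula L → H
  | _, .bot => ⊥
  | ρ, .eq t₁ t₂ => M.eq (M.term ρ t₁) (M.term ρ t₂)
  | ρ, .rel R ts => M.rel R fun k => M.term ρ (ts k)
  | ρ, .and A B => val ρ A ⊓ val ρ B
  | ρ, .or A B => val ρ A ⊔ val ρ B
  | ρ, .imp A B => val ρ A ⇨ val ρ B
  | ρ, .all x A => ⨅ a, val (Function.update ρ x a) A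
  | ρ, .ex x A => ⨆ a, val (Function.update ρ x a) A

theorem term_congr {ρ ρ' : ℕ → D} {t : L.Term ℕ} (h : ∀ x ∈ t.varFinset, ρ x = ρ' x) :
    M.term ρ t = M.term ρ' t := by
  induction t with
  | var x => exact h x (by simp)
  | func f ts ih =>
    simp only [term]
    congr 1; funext k
    exact ih k fun x hx => h x (mem_varFinset_func.2 ⟨k, hx⟩)

theorem val_congr {ρ ρ' : ℕ → D} {A : Formula L} (h : ∀ x ∈ A.freeVars, ρ x = ρ' x) :
    M.val ρ A = M.val ρ' A := by
  induction A generalizing ρ ρ' with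
  | bot => rfl
  | eq t₁ t₂ =>
    simp only [freeVars, Finset.mem_union] at h
    simp only [val]
    rw [M.term_congr fun x hx => h x (.inl hx), M.term_congr fun x hx => h x (.inr hx)]
  | rel R ts =>
    simp only [val]
    congr 1; funext k
    exact M.term_congr fun x hx => h x (mem_freeVars_rel.2 ⟨k, hx⟩)
  | and A B ihA ihB | or A B ihA ihB | imp A B ihA ihB =>
    simp only [freeVars, Finset.mem_union] at h
    simp only [val]
    rw [ihA fun x hx => h x (.inl hx), ihB fun x hx => h x (.inr hx)]
  | all y A ih | ex y A ih =>
    simp only [val]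
    congr 1; funext a
    refine ih fun x hx => ?_
    by_cases hxy : x = y
    · simp [hxy]
    · simpa [hxy] using h x (by simp [freeVars, hx, hxy])

theorem val_update_of_notMem {ρ : ℕ → D} {A : Formula L} {x : ℕ} (h : x ∉ A.freeVars)
    (a : D) : M.val (Function.update ρ x a) A = M.val ρ A :=
  M.val_congr fun y hy => Function.update_of_ne (by rintro rfl; exact h hy) _ _

theorem term_substTerm (ρ : ℕ → D) (x : ℕ) (t s : L.Term ℕ) :
    M.term ρ (substTerm x t s) = M.term (Function.update ρ x (M.term ρ t)) s := by
  induction s with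
  | var z =>
    rw [substTerm_var]
    split_ifs with h
    · simp [term, h]
    · simp [term, Function.update_of_ne h]
  | func f ts ih => simp only [substTerm_func, term]; congr 1; funext k; exact ih k

theorem val_subst {ρ : ℕ → D} {x : ℕ} {t : L.Term ℕ} {A : Formula L} (h : A.FreeFor x t) :
    M.val ρ (A.subst x t) = M.val (Function.update ρ x (M.term ρ t)) A := by
  -- Disposing of this case first leaves, at a quantifier over `y`, only `y ≠ x` and the second
  -- alternative of `FreeFor`. It must be repeated for the components of a connective, as `x` need
  -- be free in only one of them.
  by_cases hx : x ∉ A.freeVars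
  · rw [subst_of_notMem hx, M.val_update_of_notMem hx]
  induction A generalizing ρ with
  | bot => rfl
  | eq | rel => simp [subst, val, term_substTerm]
  | and A B ihA ihB | or A B ihA ihB | imp A B ihA ihB =>
    have hA : M.val ρ (A.subst x t) = M.val (Function.update ρ x (M.term ρ t)) A := by
      by_cases hx : x ∉ A.freeVars
      · rw [subst_of_notMem hx, M.val_update_of_notMem hx]
      · exact ihA h.1 hx
    have hB : M.val ρ (B.subst x t) = M.val (Function.update ρ x (M.term ρ t)) B := by
      by_cases hx : x ∉ B.freeVars
      · rw [subst_of_notMem hx, M.val_update_of_notMem hx]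
      · exact ihB h.2 hx
    simp only [subst, val, hA, hB]
  | all y A ih | ex y A ih =>
    push Not at hx
    obtain ⟨hxy, hxA⟩ := Finset.mem_erase.1 hx
    rcases h with h | ⟨hy, h⟩
    · exact absurd hx h
    · simp only [subst, Ne.symm hxy, if_false, val]
      congr 1; funext a
      rw [ih h (by simpa using hxA), Function.update_comm hxy]
      congr 2
      refine M.term_congr fun z hz => Function.update_of_ne ?_ _ _
      rintro rfl
      exact hy hz

theorem val_foldr_all {l : List ℕ} {A : Formula L} (h : ∀ ρ, M.val ρ A = ⊤) (ρ : ℕ → D) :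
    M.val ρ (l.foldr all A) = ⊤ := by
  induction l generalizing ρ with
  | nil => exact h ρ
  | cons x l ih => simp [val, ih]

theorem val_closure {A : Formula L} (h : ∀ ρ, M.val ρ A = ⊤) (ρ : ℕ → D) :
    M.val ρ A.closure = ⊤ :=
  M.val_foldr_all h ρ

theorem val_conj (ρ : ℕ → D) (As : List (Formula L)) :
    M.val ρ (conj As) = ⨅ A ∈ As, M.val ρ A := by
  induction As using conj.induct with
  | case1 => simp [conj, top, val]
  | case2 A => simp [conj]
  | case3 A B As ih =>
    rw [conj, val, ih]
    simp [iInf_or, iInf_inf_eq]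

theorem val_disj (ρ : ℕ → D) (As : List (Formula L)) :
    M.val ρ (disj As) = ⨆ A ∈ As, M.val ρ A := by
  induction As using disj.induct with
  | case1 => simp [disj, val]
  | case2 A => simp [disj]
  | case3 A B As ih =>
    rw [disj, val, ih]
    simp [iSup_or, iSup_sup_eq]

theorem val_conj_ofFn (ρ : ℕ → D) {n : ℕ} (A : Fin n → Formula L) :
    M.val ρ (conj (List.ofFn A)) = ⨅ k, M.val ρ (A k) := by
  rw [val_conj]
  simp only [List.mem_ofFn, iInf_exists]
  rw [iInf_comm]
  simp

theorem val_eqAxiom {A : Formula L} (h : EqAxiom L A) (ρ : ℕ → D) : M.val ρ A = ⊤ := by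
  induction h with
  | refl x => exact M.eq_refl _
  | symm x y => exact himp_eq_top_iff.2 (M.eq_symm _ _)
  | trans x y z => exact himp_eq_top_iff.2 (M.eq_trans _ _ _)
  | rel R x y =>
    rw [val, himp_eq_top_iff, val, le_himp_iff, eqs, val_conj_ofFn]
    exact M.rel_congr R _ _
  | func f x y =>
    rw [val, himp_eq_top_iff, eqs, val_conj_ofFn]
    exact M.func_congr f _ _

/-- Soundness of unsorted natural deduction for Heyting-valued models. -/
theorem sound {l : Logic} (hl : l = .classical → ∀ a : H, aᶜᶜ ≤ a) {P : Set (Formula L)}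
    {A : Formula L} (h : FOL l P A) (ρ : ℕ → D) : ⨅ B ∈ P, M.val ρ B ≤ M.val ρ A := by
  induction h generalizing ρ with
  | assumption h => exact iInf₂_le _ h
  | weakening h _ ih => exact (iInf_le_iInf_of_subset h).trans (ih ρ)
  | eqAxiom h => rw [M.val_closure (M.val_eqAxiom h)]; exact le_top
  | andI _ _ ih₁ ih₂ => exact le_inf (ih₁ ρ) (ih₂ ρ)
  | andE₁ _ ih => exact (ih ρ).trans inf_le_left
  | andE₂ _ ih => exact (ih ρ).trans inf_le_right
  | orI₁ _ ih => exact (ih ρ).trans le_sup_left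
  | orI₂ _ ih => exact (ih ρ).trans le_sup_right
  | orE _ _ _ ih ihA ihB =>
    have hA := ihA ρ
    have hB := ihB ρ
    rw [iInf_insert, ← le_himp_iff] at hA hB
    have := (ih ρ).trans (sup_le hA hB)
    rwa [le_himp_iff, inf_idem] at this
  | impI _ ih =>
    have := ih ρ
    rwa [iInf_insert, inf_comm, ← le_himp_iff] at this
  | impE _ _ ih₁ ih₂ => exact (le_inf (ih₁ ρ) (ih₂ ρ)).trans himp_inf_le
  | botE _ ih => exact (ih ρ).trans bot_le
  | raa hc _ ih =>
    have := ih ρ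
    rw [iInf_insert, inf_comm, ← le_himp_iff] at this
    refine this.trans (le_trans ?_ (hl hc _))
    simp [neg, val]
  | allI hx _ ih =>
    -- By the eigenvariable condition the value of the context does not depend on the value of `x`.
    refine le_iInf fun a => le_trans (le_of_eq ?_) (ih _)
    exact biInf_congr fun B hB => (M.val_update_of_notMem (hx B hB) a).symm
  | allE hf _ ih => rw [M.val_subst hf]; exact (ih ρ).trans (iInf_le _ _)
  | exI hf _ ih => exact ((ih ρ).trans_eq (M.val_subst hf)).trans (le_iSup (fun a => M.val _ _) _)
  | @exE P P' A C x hP hx hC _ _ ih₁ ih₂ =>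
    -- Moving the context to the right of `⇨` leaves a bare supremum on the left, so each witness
    -- can be treated separately and no distributivity is invoked.
    have key : M.val ρ (ex x A) ≤ (⨅ B ∈ P', M.val ρ B) ⇨ M.val ρ C := by
      refine iSup_le fun a => le_himp_iff.2 ?_
      have := ih₂ (Function.update ρ x a)
      rw [iInf_insert, M.val_update_of_notMem hC] at this
      refine le_trans (le_of_eq ?_) this
      congr 1
      exact biInf_congr fun B hB => (M.val_update_of_notMem (hx B hB) a).symm
    have := (ih₁ ρ).trans key
    rw [le_himp_iff] at this
    exact (le_inf le_rfl (iInf_le_iInf_of_subset hP)).trans this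

end HeytingModel

namespace Signature

variable {S : Signature.{u, v, w}}

/-! ## Well-sorted terms and formulas -/

theorem HasSort.var_iff {x : ℕ} {i : S.Sorts} : S.HasSort (.var x) i ↔ S.varSort x = some i :=
  ⟨fun h => by cases h; assumption, .var⟩

theorem HasSort.func_iff {n : ℕ} {f : S.lang.Functions n} {ts : Fin n → S.lang.Term ℕ}
    {i : S.Sorts} :
    S.HasSort (.func f ts) i ↔ ∃ s, (∀ k, S.HasSort (ts k) (s k)) ∧ S.rankFun f s = some i :=
  ⟨fun h => by cases h with | func h₁ h₂ => exact ⟨_, h₁, h₂⟩, fun ⟨_, h₁, h₂⟩ => .func h₁ h₂⟩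

theorem HasSort.unique {t : S.lang.Term ℕ} {i j : S.Sorts} (hi : S.HasSort t i)
    (hj : S.HasSort t j) : i = j := by
  induction hi generalizing j with
  | var h => rw [var_iff, h] at hj; exact Option.some.inj hj
  | func _ h ih =>
    obtain ⟨s', h₁, h₂⟩ := func_iff.1 hj
    rw [← funext fun k => ih k (h₁ k), h] at h₂
    exact Option.some.inj h₂

theorem HasSort.substTerm {s t : S.lang.Term ℕ} {x : ℕ} {i j : S.Sorts} (hs : S.HasSort s j)
    (hx : S.varSort x = some i) (ht : S.HasSort t i) : S.HasSort (substTerm x t s) j := by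
  induction hs with
  | var h =>
    rw [substTerm_var]
    split_ifs with hxy
    · subst hxy
      rw [hx] at h
      exact Option.some.inj h ▸ ht
    · exact .var h
  | func _ h ih => exact .func ih h

theorem HasSort.sort_of_mem {t : S.lang.Term ℕ} {i : S.Sorts} (ht : S.HasSort t i) {x : ℕ}
    (hx : x ∈ t.varFinset) : ∃ j, S.varSort x = some j := by
  induction ht with
  | var h => rw [mem_varFinset_var] at hx; exact ⟨_, hx ▸ h⟩
  | func _ _ ih =>
    obtain ⟨k, hk⟩ := mem_varFinset_func.1 hx
    exact ih k hk

theorem WellSorted.subst {φ : Formula S.lang} (h : S.WellSorted φ) {x : ℕ} {i : S.Sorts}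
    {t : S.lang.Term ℕ} (hx : S.varSort x = some i) (ht : S.HasSort t i) :
    S.WellSorted (φ.subst x t) := by
  induction h with
  | bot => exact .bot
  | eq h₁ h₂ => exact .eq (h₁.substTerm hx ht) (h₂.substTerm hx ht)
  | rel h hR => exact .rel (fun k => (h k).substTerm hx ht) hR
  | and _ _ ih₁ ih₂ => exact .and ih₁ ih₂
  | or _ _ ih₁ ih₂ => exact .or ih₁ ih₂
  | imp _ _ ih₁ ih₂ => exact .imp ih₁ ih₂
  | all hy h ih => rw [Formula.subst]; split_ifs; exacts [.all hy h, .all hy ih]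
  | ex hy h ih => rw [Formula.subst]; split_ifs; exacts [.ex hy h, .ex hy ih]

theorem WellSorted.sort_of_mem {φ : Formula S.lang} (h : S.WellSorted φ) {x : ℕ}
    (hx : x ∈ φ.freeVars) : ∃ j, S.varSort x = some j := by
  induction h with
  | bot => simp [freeVars] at hx
  | eq h₁ h₂ => exact (Finset.mem_union.1 hx).elim h₁.sort_of_mem h₂.sort_of_mem
  | rel h hR =>
    obtain ⟨k, hk⟩ := mem_freeVars_rel.1 hx
    exact (h k).sort_of_mem hk
  | and _ _ ih₁ ih₂ | or _ _ ih₁ ih₂ | imp _ _ ih₁ ih₂ =>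
    exact (Finset.mem_union.1 hx).elim ih₁ ih₂
  | all hy h ih | ex hy h ih => exact ih (Finset.mem_of_mem_erase hx)

theorem WellSorted.foldr_all {φ : Formula S.lang} (h : S.WellSorted φ) {l : List ℕ}
    (hl : ∀ x ∈ l, ∃ j, S.varSort x = some j) : S.WellSorted (l.foldr .all φ) := by
  induction l with
  | nil => exact h
  | cons x l ih =>
    obtain ⟨j, hj⟩ := hl x (by simp)
    exact .all hj (ih fun y hy => hl y (by simp [hy]))

theorem WellSorted.closure {φ : Formula S.lang} (h : S.WellSorted φ) : S.WellSorted φ.closure :=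
  h.foldr_all fun x hx => h.sort_of_mem (by simpa using hx)

theorem wellSorted_conj {As : List (Formula S.lang)} (h : ∀ A ∈ As, S.WellSorted A) :
    S.WellSorted (conj As) := by
  induction As using conj.induct with
  | case1 => exact .imp .bot .bot
  | case2 A => exact h A (by simp)
  | case3 A B As ih => exact .and (h A (by simp)) (ih fun C hC => h C (by simp [List.mem_cons.1 hC]))

theorem wellSorted_eqs {n : ℕ} {s : Fin n → S.Sorts} {x y : Fin n → ℕ}
    (hx : ∀ k, S.varSort (x k) = some (s k)) (hy : ∀ k, S.varSort (y k) = some (s k)) :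
    S.WellSorted (eqs x y) := by
  refine wellSorted_conj fun A hA => ?_
  obtain ⟨k, rfl⟩ := (List.mem_ofFn' _ _).1 hA
  exact .eq (.var (hx k)) (.var (hy k))

theorem MSEqAxiom.wellSorted {φ : Formula S.lang} (h : S.MSEqAxiom φ) : S.WellSorted φ := by
  induction h with
  | refl h => exact .eq (.var h) (.var h)
  | symm hx hy => exact .imp (.eq (.var hx) (.var hy)) (.eq (.var hy) (.var hx))
  | trans hx hy hz =>
    exact .imp (.and (.eq (.var hx) (.var hy)) (.eq (.var hy) (.var hz))) (.eq (.var hx) (.var hz))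
  | rel hs hx hy =>
    exact .imp (wellSorted_eqs hx hy)
      (.imp (.rel (fun k => .var (hx k)) hs) (.rel (fun k => .var (hy k)) hs))
  | func hf hx hy =>
    exact .imp (wellSorted_eqs hx hy)
      (.eq (.func (fun k => .var (hx k)) hf) (.func (fun k => .var (hy k)) hf))

theorem exists_fresh (i : S.Sorts) (V : Finset ℕ) : ∃ x, S.varSort x = some i ∧ x ∉ V :=
  (S.infinite_vars i).exists_notMem_finset V

theorem exists_fresh_tuple {n : ℕ} (s : Fin n → S.Sorts) (V : Finset ℕ) :
    ∃ x : Fin n → ℕ, Function.Injective x ∧ (∀ k, S.varSort (x k) = some (s k)) ∧ ∀ k, x k ∉ V := by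
  induction n generalizing V with
  | zero => exact ⟨finZeroElim, Function.injective_of_subsingleton _, finZeroElim, finZeroElim⟩
  | succ n ih =>
    obtain ⟨x₀, h₀, hV₀⟩ := S.exists_fresh (s 0) V
    obtain ⟨x, hx, hs, hV⟩ := ih (Fin.tail s) (insert x₀ V)
    simp only [Finset.mem_insert, not_or] at hV
    refine ⟨Fin.cons x₀ x, ?_, ?_, ?_⟩
    · rw [Fin.cons_injective_iff]
      exact ⟨by rintro ⟨k, hk⟩; exact (hV k).1 hk, hx⟩
    · exact Fin.cases h₀ hs
    · exact Fin.cases hV₀ fun k => (hV k).2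

/-! ## Derived rules of many-sorted natural deduction -/

namespace MSL

variable {l : Logic} {Γ : Set (Formula S.lang)} {φ ψ χ : Formula S.lang}

theorem wellSorted (h : S.MSL l Γ φ) : S.WellSorted φ := by
  induction h with
  | assumption h _ => exact h
  | weakening _ _ ih => exact ih
  | eqAxiom h => exact h.wellSorted.closure
  | andI _ _ ih₁ ih₂ => exact .and ih₁ ih₂
  | andE₁ _ ih => cases ih; assumption
  | andE₂ _ ih => cases ih; assumption
  | orI₁ h _ ih => exact .or ih h
  | orI₂ h _ ih => exact .or h ih
  | orE _ _ _ _ ih _ => exact ih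
  | impI h _ ih => exact .imp h ih
  | impE _ _ ih _ => cases ih; assumption
  | botE h _ _ => exact h
  | raa _ h _ _ => exact h
  | allI hx _ _ ih => exact .all hx ih
  | allE hx ht _ _ ih => cases ih with | all _ h => exact h.subst hx ht
  | exI hx _ _ h _ _ => exact .ex hx h
  | exE _ _ _ _ _ _ ih => exact ih

theorem cut (h : S.MSL l Γ φ) (h' : S.MSL l (insert φ Γ) ψ) : S.MSL l Γ ψ :=
  .impE (.impI h.wellSorted h') h

theorem trans (h : S.MSL l Γ φ) (h' : S.MSL l {φ} ψ) : S.MSL l Γ ψ :=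
  h.cut (.weakening (by simp) h')

theorem head (h : S.WellSorted φ) : S.MSL l (insert φ Γ) φ :=
  .assumption h (Set.mem_insert _ _)

theorem self (h : S.WellSorted φ) : S.MSL l {φ} φ :=
  .assumption h rfl

theorem allE_self {x : ℕ} (h : S.MSL l Γ (.all x φ)) : S.MSL l Γ φ := by
  cases h.wellSorted with
  | all hx _ => simpa using h.allE hx (.var hx) (freeFor_self x φ)

theorem exI_self {x : ℕ} {i : S.Sorts} (hx : S.varSort x = some i) (h : S.MSL l Γ φ) :
    S.MSL l Γ (.ex x φ) :=
  .exI hx (.var hx) (freeFor_self x φ) h.wellSorted (by simpa using h)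

theorem conjI {As : List (Formula S.lang)} (h : ∀ A ∈ As, S.MSL l Γ A) : S.MSL l Γ (conj As) := by
  induction As using conj.induct with
  | case1 => exact .impI .bot (head .bot)
  | case2 A => exact h A (by simp)
  | case3 A B As ih => exact .andI (h A (by simp)) (ih fun C hC => h C (by simp [List.mem_cons.1 hC]))

theorem and_mono {φ' ψ' : Formula S.lang} (h : S.MSL l {φ} φ') (h' : S.MSL l {ψ} ψ')
    (hφ : S.WellSorted φ) (hψ : S.WellSorted ψ) : S.MSL l {.and φ ψ} (.and φ' ψ') :=
  have h₀ : S.MSL l {.and φ ψ} (.and φ ψ) := self (.and hφ hψ)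
  .andI (h₀.andE₁.trans h) (h₀.andE₂.trans h')

theorem or_mono {φ' ψ' : Formula S.lang} (h : S.MSL l {φ} φ') (h' : S.MSL l {ψ} ψ')
    (hφ : S.WellSorted φ) (hψ : S.WellSorted ψ) : S.MSL l {.or φ ψ} (.or φ' ψ') :=
  .orE (self (.or hφ hψ)) (.orI₁ h'.wellSorted ((head hφ).trans h))
    (.orI₂ h.wellSorted ((head hψ).trans h'))

theorem imp_mono {φ' ψ' : Formula S.lang} (h : S.MSL l {φ'} φ) (h' : S.MSL l {ψ} ψ')
    (hφ' : S.WellSorted φ') (hψ : S.WellSorted ψ) : S.MSL l {.imp φ ψ} (.imp φ' ψ') :=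
  .impI hφ' (.trans (.impE (.assumption (.imp h.wellSorted hψ) (by simp)) ((head hφ').trans h)) h')

theorem all_mono {x : ℕ} {i : S.Sorts} (hx : S.varSort x = some i) (h : S.MSL l {φ} ψ)
    (hφ : S.WellSorted φ) : S.MSL l {.all x φ} (.all x ψ) :=
  .allI hx (by simp [freeVars]) ((self (.all hx hφ)).allE_self.trans h)

theorem ex_mono {x : ℕ} {i : S.Sorts} (hx : S.varSort x = some i) (h : S.MSL l {φ} ψ)
    (hφ : S.WellSorted φ) : S.MSL l {.ex x φ} (.ex x ψ) :=
  .exE (Set.empty_subset _) (by simp) (by simp [freeVars]) (self (.ex hx hφ))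
    (exI_self hx ((head hφ).trans h))

theorem notMem_freeVars_of_subst (x y : ℕ) (φ : Formula S.lang) :
    x ∉ (φ.subst x (.var y)).freeVars.erase y := by
  intro h
  rw [Finset.mem_erase] at h
  have := mem_freeVars_subst h.2
  simp [h.1] at this

/-! ### Renaming a bound variable within many-sorted derivations -/

section Rename

variable {x y : ℕ} {i : S.Sorts} (hx : S.varSort x = some i) (hy : S.varSort y = some i)
  (hf : y ∉ φ.freeVars) (hb : y ∉ φ.boundVars) (hφ : S.WellSorted φ)

include hx hy hf hb hφ

theorem all_rename : S.MSL l {.all x φ} (.all y (φ.subst x (.var y))) :=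
  .allI hy (by simp [freeVars, hf]) (.allE hx (.var hy) (freeFor_var hb) (self (.all hx hφ)))

theorem all_rename_symm : S.MSL l {.all y (φ.subst x (.var y))} (.all x φ) := by
  refine .allI hx (by simpa [freeVars] using notMem_freeVars_of_subst x y φ) ?_
  have := allE hy (.var hx) (freeFor_back hf hb)
    (self (l := l) (.all hy (hφ.subst hx (.var hy))))
  rwa [subst_back hf hb] at this

theorem ex_rename : S.MSL l {.ex x φ} (.ex y (φ.subst x (.var y))) := by
  refine .exE (Set.empty_subset _) (by simp) (notMem_freeVars_of_subst x y φ) (self (.ex hx hφ)) ?_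
  refine .exI hy (.var hx) (freeFor_back hf hb) (hφ.subst hx (.var hy)) ?_
  rw [subst_back hf hb]
  exact head hφ

theorem ex_rename_symm : S.MSL l {.ex y (φ.subst x (.var y))} (.ex x φ) :=
  .exE (Set.empty_subset _) (by simp) (by simp [freeVars, hf])
    (self (.ex hy (hφ.subst hx (.var hy))))
    (.exI hx (.var hy) (freeFor_var hb) hφ (head (hφ.subst hx (.var hy))))

end Rename

/-! ### Equality of terms -/

theorem inst_closure {σ : ℕ → S.lang.Term ℕ} (h : S.MSL l Γ φ.closure) (hφ : φ.QuantifierFree)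
    (hok : ∀ x ∈ φ.freeVars, ∃ i, S.varSort x = some i ∧ S.HasSort (σ x) i)
    (hσ : ∀ x ∈ φ.freeVars, ∀ y ∈ φ.freeVars, y ∉ (σ x).varFinset) : S.MSL l Γ (φ.substAll σ) :=
  instantiate_closure (ok := fun x t => ∃ i, S.varSort x = some i ∧ S.HasSort t i)
    (fun ⟨_, hx, ht⟩ hf h => h.allE hx ht hf) hφ hok hσ h

/-- The equality axioms speak of variables only. To reach terms, the axiom is taken for variables of
the right sort that avoid the terms involved, which is the freshness that `inst_closure` requires.
The other equality laws below follow the same pattern. -/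
theorem eq_refl {t : S.lang.Term ℕ} {i : S.Sorts} (ht : S.HasSort t i) :
    S.MSL l Γ (.eq t t) := by
  obtain ⟨x, hx, hxt⟩ := S.exists_fresh i t.varFinset
  refine inst_closure (σ := fun _ => t) (.eqAxiom (.refl hx)) trivial ?_ ?_
  · simp [freeVars, hx, ht]
  · simp [freeVars, hxt]

theorem eq_symm {t u : S.lang.Term ℕ} {i : S.Sorts} (ht : S.HasSort t i) (hu : S.HasSort u i)
    (h : S.MSL l Γ (.eq t u)) : S.MSL l Γ (.eq u t) := by
  obtain ⟨x, hx, hxV⟩ := S.exists_fresh i (t.varFinset ∪ u.varFinset)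
  obtain ⟨y, hy, hyV⟩ := S.exists_fresh i (insert x (t.varFinset ∪ u.varFinset))
  simp only [Finset.mem_insert, Finset.mem_union, not_or] at hxV hyV
  have := inst_closure (l := l) (Γ := Γ) (σ := fun z => if z = x then t else u)
    (.eqAxiom (.symm hx hy)) ⟨trivial, trivial⟩
    (by simp [freeVars, hx, hy, ht, hu, hyV.1]) (by simp [freeVars, hxV, hyV])
  simp [substAll, hyV.1] at this
  exact this.impE h

theorem eq_trans {t u v : S.lang.Term ℕ} {i : S.Sorts} (ht : S.HasSort t i) (hu : S.HasSort u i)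
    (hv : S.HasSort v i) (h : S.MSL l Γ (.eq t u)) (h' : S.MSL l Γ (.eq u v)) :
    S.MSL l Γ (.eq t v) := by
  obtain ⟨x, hx, hxV⟩ := S.exists_fresh i (t.varFinset ∪ u.varFinset ∪ v.varFinset)
  obtain ⟨y, hy, hyV⟩ := S.exists_fresh i (insert x (t.varFinset ∪ u.varFinset ∪ v.varFinset))
  obtain ⟨z, hz, hzV⟩ :=
    S.exists_fresh i (insert y (insert x (t.varFinset ∪ u.varFinset ∪ v.varFinset)))
  simp only [Finset.mem_insert, Finset.mem_union, not_or] at hxV hyV hzV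
  have := inst_closure (l := l) (Γ := Γ) (σ := fun w => if w = x then t else if w = y then u else v)
    (.eqAxiom (.trans hx hy hz)) ⟨⟨trivial, trivial⟩, trivial⟩
    (by simp [freeVars, hx, hy, hz, ht, hu, hv, hyV.1, hzV])
    (by simp [freeVars, hxV, hyV, hzV])
  simp [substAll, hyV.1, hzV] at this
  exact this.impE (.andI h h')

/-- Two tuples of terms are instances of two tuples of fresh variables. -/
theorem exists_fresh_subst {n : ℕ} {s : Fin n → S.Sorts} {ts us : Fin n → S.lang.Term ℕ}
    (ht : ∀ k, S.HasSort (ts k) (s k)) (hu : ∀ k, S.HasSort (us k) (s k)) :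
    ∃ (x y : Fin n → ℕ) (σ : ℕ → S.lang.Term ℕ), (∀ k, S.varSort (x k) = some (s k)) ∧
      (∀ k, S.varSort (y k) = some (s k)) ∧ (∀ k, σ (x k) = ts k) ∧ (∀ k, σ (y k) = us k) ∧
      (∀ z, ((∃ k, z = x k) ∨ ∃ k, z = y k) → (∃ i, S.varSort z = some i ∧ S.HasSort (σ z) i) ∧
        ∀ z', ((∃ k, z' = x k) ∨ ∃ k, z' = y k) → z' ∉ (σ z).varFinset) := by
  let V := Finset.univ.biUnion fun k => (ts k).varFinset ∪ (us k).varFinset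
  obtain ⟨x, hxi, hx, hxV⟩ := S.exists_fresh_tuple s V
  obtain ⟨y, hyi, hy, hyV⟩ := S.exists_fresh_tuple s (V ∪ Finset.univ.image x)
  -- This is the substitution sending `x k` to `ts k`, `y k` to `us k` and fixing all other
  -- variables. It is consistent because both tuples are injective and `y` was chosen off the image
  -- of `x`.
  have hσx : ∀ k, Function.extend x ts (Function.extend y us Term.var) (x k) = ts k :=
    fun k => hxi.extend_apply _ _ k
  have hσy : ∀ k, Function.extend x ts (Function.extend y us Term.var) (y k) = us k := by
    intro k
    rw [Function.extend_apply', hyi.extend_apply]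
    rintro ⟨j, hj⟩
    exact hyV k (by simp [← hj])
  have hV : ∀ z', ((∃ k, z' = x k) ∨ ∃ k, z' = y k) → z' ∉ V := by
    rintro z' (⟨k, rfl⟩ | ⟨k, rfl⟩) h
    · exact hxV k h
    · exact hyV k (by simp [h])
  simp only [V, Finset.mem_biUnion, Finset.mem_univ, true_and, Finset.mem_union, not_exists,
    not_or] at hV
  refine ⟨x, y, _, hx, hy, hσx, hσy, ?_⟩
  rintro z (⟨k, rfl⟩ | ⟨k, rfl⟩)
  · rw [hσx]
    exact ⟨⟨_, hx k, ht k⟩, fun z' hz' => (hV z' hz' k).1⟩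
  · rw [hσy]
    exact ⟨⟨_, hy k, hu k⟩, fun z' hz' => (hV z' hz' k).2⟩

theorem mem_freeVars_eqs {n : ℕ} {x y : Fin n → ℕ} {z : ℕ} :
    z ∈ (eqs (L := S.lang) x y).freeVars ↔ (∃ k, z = x k) ∨ ∃ k, z = y k := by
  simp [eqs, mem_freeVars_conj, List.mem_ofFn, freeVars, exists_or]

theorem quantifierFree_eqs {n : ℕ} {x y : Fin n → ℕ} : (eqs (L := S.lang) x y).QuantifierFree := by
  refine quantifierFree_conj fun A hA => ?_
  obtain ⟨k, rfl⟩ := (List.mem_ofFn' _ _).1 hA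
  trivial

theorem substAll_eqs {n : ℕ} {x y : Fin n → ℕ} (σ : ℕ → S.lang.Term ℕ) :
    (eqs (L := S.lang) x y).substAll σ = conj (List.ofFn fun k => .eq (σ (x k)) (σ (y k))) := by
  rw [eqs, substAll_conj, List.map_ofFn]
  rfl

theorem rel_congr {n : ℕ} {R : S.lang.Relations n} {s : Fin n → S.Sorts} (hs : s ∈ S.rankRel R)
    {ts us : Fin n → S.lang.Term ℕ} (ht : ∀ k, S.HasSort (ts k) (s k))
    (hu : ∀ k, S.HasSort (us k) (s k)) (h : ∀ k, S.MSL l Γ (.eq (ts k) (us k)))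
    (h' : S.MSL l Γ (.rel R ts)) : S.MSL l Γ (.rel R us) := by
  obtain ⟨x, y, σ, hx, hy, hσx, hσy, H⟩ := exists_fresh_subst ht hu
  have hF : ∀ z ∈ (imp (eqs x y) (imp (rel R fun k => .var (x k))
      (rel R fun k => .var (y k)))).freeVars, (∃ k, z = x k) ∨ ∃ k, z = y k := by
    intro z hz
    simpa [freeVars, mem_freeVars_eqs] using hz
  have := inst_closure (l := l) (Γ := Γ) (σ := σ) (.eqAxiom (.rel hs hx hy))
    ⟨quantifierFree_eqs, trivial, trivial⟩ (fun z hz => (H z (hF z hz)).1)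
    (fun z hz z' hz' => (H z (hF z hz)).2 z' (hF z' hz'))
  simp only [substAll, substAll_eqs, Term.subst, hσx, hσy] at this
  refine (this.impE (conjI fun A hA => ?_)).impE h'
  obtain ⟨k, rfl⟩ := (List.mem_ofFn' _ _).1 hA
  exact h k

theorem func_congr {n : ℕ} {f : S.lang.Functions n} {s : Fin n → S.Sorts} {i : S.Sorts}
    (hs : S.rankFun f s = some i)
    {ts us : Fin n → S.lang.Term ℕ} (ht : ∀ k, S.HasSort (ts k) (s k))
    (hu : ∀ k, S.HasSort (us k) (s k)) (h : ∀ k, S.MSL l Γ (.eq (ts k) (us k))) :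
    S.MSL l Γ (.eq (.func f ts) (.func f us)) := by
  obtain ⟨x, y, σ, hx, hy, hσx, hσy, H⟩ := exists_fresh_subst ht hu
  have hF : ∀ z ∈ (imp (eqs x y) (eq (.func f fun k => .var (x k))
      (.func f fun k => .var (y k)))).freeVars, (∃ k, z = x k) ∨ ∃ k, z = y k := by
    intro z hz
    simpa [freeVars, mem_freeVars_eqs, mem_varFinset_func] using hz
  have := inst_closure (l := l) (Γ := Γ) (σ := σ) (.eqAxiom (.func hs hx hy))
    ⟨quantifierFree_eqs, trivial⟩ (fun z hz => (H z (hF z hz)).1)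
    (fun z hz z' hz' => (H z (hF z hz)).2 z' (hF z' hz'))
  simp only [substAll, substAll_eqs, Term.subst, hσx, hσy] at this
  refine this.impE (conjI fun A hA => ?_)
  obtain ⟨k, rfl⟩ := (List.mem_ofFn' _ _).1 hA
  exact h k

end MSL

end Signature

namespace Signature

variable {S : Signature.{u, v, w}}

/-! ## The translation, free variables and substitution -/

@[simp]
theorem starTerm_var (x : ℕ) : S.starTerm (.var x) = .var x := rfl

theorem starTerm_func {n : ℕ} (f : S.lang.Functions n) (ts : Fin n → S.lang.Term ℕ) :
    S.starTerm (.func f ts) = Term.func (S.starHom.onFunction f) fun k => S.starTerm (ts k) := rfl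

@[simp]
theorem varFinset_starTerm (t : S.lang.Term ℕ) : (S.starTerm t).varFinset = t.varFinset := by
  induction t with
  | var x => rfl
  | func f ts ih =>
    ext y
    rw [starTerm_func, mem_varFinset_func, mem_varFinset_func]
    simp [ih]

theorem starTerm_substTerm (x : ℕ) (t s : S.lang.Term ℕ) :
    S.starTerm (substTerm x t s) = substTerm x (S.starTerm t) (S.starTerm s) := by
  induction s with
  | var y => simp only [substTerm_var, starTerm_var]; split_ifs <;> rfl
  | func f ts ih => simp only [substTerm_func, starTerm_func, ih]

@[simp]
theorem freeVars_sortAtom (i : S.Sorts) (t : S.starLang.Term ℕ) :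
    (S.sortAtom i t).freeVars = t.varFinset := by
  simp [sortAtom, freeVars]

theorem star_all {x : ℕ} {i : S.Sorts} (h : S.varSort x = some i) (φ : Formula S.lang) :
    S.star (.all x φ) = .all x (.imp (S.sortAtom i (.var x)) (S.star φ)) := by
  simp [star, h]

theorem star_ex {x : ℕ} {i : S.Sorts} (h : S.varSort x = some i) (φ : Formula S.lang) :
    S.star (.ex x φ) = .ex x (.and (S.sortAtom i (.var x)) (S.star φ)) := by
  simp [star, h]

theorem star_all_none {x : ℕ} (h : S.varSort x = none) (φ : Formula S.lang) :
    S.star (.all x φ) = .all x (S.star φ) := by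
  simp [star, h]

@[simp]
theorem freeVars_star (φ : Formula S.lang) : (S.star φ).freeVars = φ.freeVars := by
  induction φ with
  | bot => rfl
  | eq t₁ t₂ => simp [star, freeVars]
  | rel R ts => simp [star, freeVars]
  | and A B ihA ihB | or A B ihA ihB | imp A B ihA ihB => simp [star, freeVars, ihA, ihB]
  | all y A ih | ex y A ih =>
    cases h : S.varSort y <;> ext z <;> simp [star, h, freeVars, ih]

theorem star_subst (x : ℕ) (t : S.lang.Term ℕ) (φ : Formula S.lang) :
    S.star (φ.subst x t) = (S.star φ).subst x (S.starTerm t) := by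
  induction φ with
  | bot => rfl
  | eq | rel => simp [star, Formula.subst, starTerm_substTerm]
  | and A B ihA ihB | or A B ihA ihB | imp A B ihA ihB => simp [star, Formula.subst, ihA, ihB]
  | all y A ih | ex y A ih =>
    by_cases hy : y = x
    · subst hy
      cases h : S.varSort y <;> simp [star, h, Formula.subst]
    · cases h : S.varSort y <;> simp [star, h, Formula.subst, ih, hy, sortAtom]

theorem freeFor_star {x : ℕ} {t : S.lang.Term ℕ} {φ : Formula S.lang} (h : φ.FreeFor x t) :
    (S.star φ).FreeFor x (S.starTerm t) := by
  induction φ with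
  | bot | eq | rel => trivial
  | and A B ihA ihB | or A B ihA ihB | imp A B ihA ihB => exact ⟨ihA h.1, ihB h.2⟩
  | all y A ih | ex y A ih =>
    rcases h with h | ⟨hy, h⟩
    · exact freeFor_of_notMem (by rwa [freeVars_star])
    · have hy' : y ∉ (S.starTerm t).varFinset := by rwa [varFinset_starTerm]
      cases hs : S.varSort y
      · simp only [star, hs]
        exact .inr ⟨hy', ih h⟩
      · simp only [star, hs]
        exact .inr ⟨hy', trivial, ih h⟩

/-! ## Renaming of bound variables -/

section Variant

variable {H D : Type*} [Order.Frame H] (M : HeytingModel S.starLang H D) (l : Logic)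

/-- `φ'` is provably equivalent to `φ`, and their translations have the same values. -/
structure Variant (φ φ' : Formula S.lang) : Prop where
  wellSorted : S.WellSorted φ'
  size_eq : φ'.size = φ.size
  mp : S.MSL l {φ} φ'
  mpr : S.MSL l {φ'} φ
  val_eq : ∀ ρ, M.val ρ (S.star φ') = M.val ρ (S.star φ)

/-- Old and new variable have the same sort, so the guards agree, and the bodies agree by the
substitution lemma. -/
theorem val_all_rename {x y : ℕ} {i : S.Sorts} (hx : S.varSort x = some i)
    (hy : S.varSort y = some i) {φ : Formula S.lang} (hf : y ∉ φ.freeVars)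
    (hb : y ∉ φ.boundVars) (ρ : ℕ → D) :
    M.val ρ (S.star (.all y (φ.subst x (.var y)))) = M.val ρ (S.star (.all x φ)) := by
  rw [star_all hy, star_all hx]
  simp only [HeytingModel.val, sortAtom]
  congr 1; funext a
  congr 1
  · simp [HeytingModel.term]
  · rw [star_subst, M.val_subst (freeFor_star (freeFor_var hb))]
    refine M.val_congr fun z hz => ?_
    have hzy : z ≠ y := by rintro rfl; exact hf (by simpa using hz)
    by_cases hzx : z = x <;> simp [hzx, hzy, HeytingModel.term]

theorem val_ex_rename {x y : ℕ} {i : S.Sorts} (hx : S.varSort x = some i)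
    (hy : S.varSort y = some i) {φ : Formula S.lang} (hf : y ∉ φ.freeVars)
    (hb : y ∉ φ.boundVars) (ρ : ℕ → D) :
    M.val ρ (S.star (.ex y (φ.subst x (.var y)))) = M.val ρ (S.star (.ex x φ)) := by
  rw [star_ex hy, star_ex hx]
  simp only [HeytingModel.val, sortAtom]
  congr 1; funext a
  congr 1
  · simp [HeytingModel.term]
  · rw [star_subst, M.val_subst (freeFor_star (freeFor_var hb))]
    refine M.val_congr fun z hz => ?_
    have hzy : z ≠ y := by rintro rfl; exact hf (by simpa using hz)
    by_cases hzx : z = x <;> simp [hzx, hzy, HeytingModel.term]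

/-- The bound variables of a formula can be renamed to avoid a finite set. -/
theorem exists_variant {φ : Formula S.lang} (h : S.WellSorted φ) (V : Finset ℕ) :
    ∃ φ', S.Variant M l φ φ' ∧ Disjoint φ'.boundVars V := by
  induction h generalizing V with
  | bot => exact ⟨_, ⟨.bot, rfl, .self .bot, .self .bot, fun _ => rfl⟩, by simp [boundVars]⟩
  | eq h₁ h₂ =>
    have h := WellSorted.eq h₁ h₂
    exact ⟨_, ⟨h, rfl, .self h, .self h, fun _ => rfl⟩, by simp [boundVars]⟩
  | rel h₁ h₂ =>
    have h := WellSorted.rel h₁ h₂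
    exact ⟨_, ⟨h, rfl, .self h, .self h, fun _ => rfl⟩, by simp [boundVars]⟩
  | and hφ hψ ihφ ihψ =>
    obtain ⟨φ', hφ', dφ⟩ := ihφ V
    obtain ⟨ψ', hψ', dψ⟩ := ihψ V
    exact ⟨.and φ' ψ', ⟨.and hφ'.1 hψ'.1, by simp [size, hφ'.2, hψ'.2],
      .and_mono hφ'.3 hψ'.3 hφ hψ, .and_mono hφ'.4 hψ'.4 hφ'.1 hψ'.1,
      fun ρ => by simp [star, HeytingModel.val, hφ'.5, hψ'.5]⟩,
      Finset.disjoint_union_left.2 ⟨dφ, dψ⟩⟩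
  | or hφ hψ ihφ ihψ =>
    obtain ⟨φ', hφ', dφ⟩ := ihφ V
    obtain ⟨ψ', hψ', dψ⟩ := ihψ V
    exact ⟨.or φ' ψ', ⟨.or hφ'.1 hψ'.1, by simp [size, hφ'.2, hψ'.2],
      .or_mono hφ'.3 hψ'.3 hφ hψ, .or_mono hφ'.4 hψ'.4 hφ'.1 hψ'.1,
      fun ρ => by simp [star, HeytingModel.val, hφ'.5, hψ'.5]⟩,
      Finset.disjoint_union_left.2 ⟨dφ, dψ⟩⟩
  | imp hφ hψ ihφ ihψ =>
    obtain ⟨φ', hφ', dφ⟩ := ihφ V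
    obtain ⟨ψ', hψ', dψ⟩ := ihψ V
    exact ⟨.imp φ' ψ', ⟨.imp hφ'.1 hψ'.1, by simp [size, hφ'.2, hψ'.2],
      .imp_mono hφ'.4 hψ'.3 hφ'.1 hψ, .imp_mono hφ'.3 hψ'.4 hφ hψ'.1,
      fun ρ => by simp [star, HeytingModel.val, hφ'.5, hψ'.5]⟩,
      Finset.disjoint_union_left.2 ⟨dφ, dψ⟩⟩
  | @all x i φ hx hφ ih =>
    obtain ⟨φ', hφ', dφ⟩ := ih V
    obtain ⟨y, hy, hyV⟩ := S.exists_fresh i (V ∪ φ'.freeVars ∪ φ'.boundVars)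
    simp only [Finset.mem_union, not_or] at hyV
    obtain ⟨⟨hyV, hf⟩, hb⟩ := hyV
    refine ⟨.all y (φ'.subst x (.var y)), ⟨.all hy (hφ'.1.subst hx (.var hy)),
      by simp [size, hφ'.2], (MSL.all_mono hx hφ'.3 hφ).trans (.all_rename hx hy hf hb hφ'.1),
      (MSL.all_rename_symm hx hy hf hb hφ'.1).trans (.all_mono hx hφ'.4 hφ'.1), fun ρ => ?_⟩, ?_⟩
    · rw [val_all_rename M hx hy hf hb, star_all hx, star_all hx]
      simp [HeytingModel.val, hφ'.5]
    · simpa [boundVars, hyV] using dφ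
  | @ex x i φ hx hφ ih =>
    obtain ⟨φ', hφ', dφ⟩ := ih V
    obtain ⟨y, hy, hyV⟩ := S.exists_fresh i (V ∪ φ'.freeVars ∪ φ'.boundVars)
    simp only [Finset.mem_union, not_or] at hyV
    obtain ⟨⟨hyV, hf⟩, hb⟩ := hyV
    refine ⟨.ex y (φ'.subst x (.var y)), ⟨.ex hy (hφ'.1.subst hx (.var hy)),
      by simp [size, hφ'.2], (MSL.ex_mono hx hφ'.3 hφ).trans (.ex_rename hx hy hf hb hφ'.1),
      (MSL.ex_rename_symm hx hy hf hb hφ'.1).trans (.ex_mono hx hφ'.4 hφ'.1), fun ρ => ?_⟩, ?_⟩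
    · rw [val_ex_rename M hx hy hf hb, star_ex hx, star_ex hx]
      simp [HeytingModel.val, hφ'.5]
    · simpa [boundVars, hyV] using dφ

end Variant

end Signature

namespace Signature

/-! ## The truth values of the term model -/

/-- The well-sorted formulas, preordered by derivability from `Γ`. -/
structure Lindenbaum (S : Signature.{u, v, w}) (_l : Logic) (_Γ : Set (Formula S.lang)) where
  formula : Formula S.lang
  wellSorted : S.WellSorted formula

variable {S : Signature.{u, v, w}} {l : Logic} {Γ : Set (Formula S.lang)}

instance : Preorder (S.Lindenbaum l Γ) where
  le φ ψ := S.MSL l (insert φ.1 Γ) ψ.1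
  le_refl φ := .head φ.2
  le_trans φ ψ χ h₁ h₂ := h₁.cut (.weakening (Set.insert_subset_insert (Set.subset_insert _ _)) h₂)

/-- The Dedekind-MacNeille completion of the well-sorted formulas. -/
def Truth (S : Signature.{u, v, w}) (l : Logic) (Γ : Set (Formula S.lang)) : Type (max u v) :=
  DedekindCut (S.Lindenbaum l Γ)

instance : CompleteLattice (S.Truth l Γ) :=
  inferInstanceAs (CompleteLattice (DedekindCut (S.Lindenbaum l Γ)))

/-- The truth value of a well-sorted formula. -/
def prin (φ : S.Lindenbaum l Γ) : S.Truth l Γ :=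
  DedekindCut.principal φ

theorem prin_le_prin {φ ψ : S.Lindenbaum l Γ} :
    prin φ ≤ prin ψ ↔ S.MSL l (insert φ.1 Γ) ψ.1 :=
  DedekindCut.principal_le_principal

/-- A cut is determined by its lower set, and in `le_of_le_prin` by its upper set. Inequalities in
the completion can therefore be tested on formulas from either side, which reduces all later
computations to derivations. -/
theorem le_of_prin_le {a b : S.Truth l Γ} (h : ∀ φ, prin φ ≤ a → prin φ ≤ b) : a ≤ b :=
  Concept.extent_subset_extent_iff.1 fun φ hφ =>
    DedekindCut.principal_le_iff.1 (h φ (DedekindCut.principal_le_iff.2 hφ))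

theorem le_of_le_prin {a b : S.Truth l Γ} (h : ∀ φ, b ≤ prin φ → a ≤ prin φ) : a ≤ b :=
  Concept.intent_subset_intent_iff.1 fun φ hφ =>
    DedekindCut.le_principal_iff.1 (h φ (DedekindCut.le_principal_iff.2 hφ))

theorem prin_inf_prin_le {φ ψ χ : S.Lindenbaum l Γ} :
    prin φ ⊓ prin ψ ≤ prin χ ↔ S.MSL l (insert ψ.1 (insert φ.1 Γ)) χ.1 := by
  constructor
  · intro h
    have h₁ : prin (l := l) (Γ := Γ) ⟨.and φ.1 ψ.1, .and φ.2 ψ.2⟩ ≤ prin χ :=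
      (le_inf (prin_le_prin.2 (MSL.head (.and φ.2 ψ.2)).andE₁)
        (prin_le_prin.2 (MSL.head (.and φ.2 ψ.2)).andE₂)).trans h
    refine MSL.cut (.andI (.assumption φ.2 (by simp)) (.assumption ψ.2 (by simp)))
      (.weakening (Set.insert_subset_insert ?_) (prin_le_prin.1 h₁))
    exact (Set.subset_insert _ _).trans (Set.subset_insert _ _)
  · refine fun h => le_of_prin_le fun θ hθ => ?_
    have h₁ := prin_le_prin.1 (hθ.trans inf_le_left)
    have h₂ := prin_le_prin.1 (hθ.trans inf_le_right)
    refine prin_le_prin.2 (h₁.cut (.cut (.weakening (Set.subset_insert _ _) h₂) (.weakening ?_ h)))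
    exact Set.insert_subset_insert (Set.insert_subset_insert (Set.subset_insert _ _))

theorem prin_inf_prin_le_iff_imp {φ ψ χ : S.Lindenbaum l Γ} :
    prin φ ⊓ prin ψ ≤ prin χ ↔ prin φ ≤ prin ⟨.imp ψ.1 χ.1, .imp ψ.2 χ.2⟩ := by
  rw [prin_inf_prin_le, prin_le_prin]
  refine ⟨.impI ψ.2, fun h => .impE (.weakening (Set.subset_insert _ _) h) (.head ψ.2)⟩

/-- Test with a formula `χ` below the left side and a formula `ψ` above the right side. Any `ξ`
below a member of `s` satisfies `χ ∧ ξ ≤ ψ`, so `ξ ≤ χ → ψ`. Thus `sSup s ≤ χ → ψ`, and as `χ ≤ sSup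
s`, also `χ ≤ ψ`. -/
theorem inf_sSup_le_iSup_inf (a : S.Truth l Γ) (s : Set (S.Truth l Γ)) :
    a ⊓ sSup s ≤ ⨆ b ∈ s, a ⊓ b := by
  refine le_of_le_prin fun ψ hψ => le_of_prin_le fun χ hχ => ?_
  have h : sSup s ≤ prin ⟨.imp χ.1 ψ.1, .imp χ.2 ψ.2⟩ := by
    refine sSup_le fun b hb => le_of_prin_le fun ξ hξ => ?_
    rw [← prin_inf_prin_le_iff_imp, inf_comm]
    refine le_trans ?_ ((le_iSup₂ (f := fun b (_ : b ∈ s) => a ⊓ b) b hb).trans hψ)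
    exact inf_le_inf (hχ.trans inf_le_left) hξ
  have := (hχ.trans inf_le_right).trans h
  rwa [← prin_inf_prin_le_iff_imp, inf_idem] at this

noncomputable instance : Order.Frame (S.Truth l Γ) :=
  Order.Frame.ofMinimalAxioms ⟨inf_sSup_le_iSup_inf⟩

theorem prin_himp_prin (φ ψ : S.Lindenbaum l Γ) :
    prin φ ⇨ prin ψ = prin ⟨.imp φ.1 ψ.1, .imp φ.2 ψ.2⟩ := by
  apply le_antisymm
  · refine le_of_prin_le fun χ hχ => ?_
    rwa [le_himp_iff, prin_inf_prin_le_iff_imp] at hχ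
  · rw [le_himp_iff, prin_inf_prin_le_iff_imp]

theorem prin_inf_prin (φ ψ : S.Lindenbaum l Γ) :
    prin φ ⊓ prin ψ = prin ⟨.and φ.1 ψ.1, .and φ.2 ψ.2⟩ := by
  apply le_antisymm
  · rw [prin_inf_prin_le]
    exact .andI (.assumption φ.2 (by simp)) (.assumption ψ.2 (by simp))
  · exact le_inf (prin_le_prin.2 (MSL.head (.and φ.2 ψ.2)).andE₁)
      (prin_le_prin.2 (MSL.head (.and φ.2 ψ.2)).andE₂)

theorem prin_sup_prin (φ ψ : S.Lindenbaum l Γ) :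
    prin φ ⊔ prin ψ = prin ⟨.or φ.1 ψ.1, .or φ.2 ψ.2⟩ := by
  apply le_antisymm
  · exact sup_le (prin_le_prin.2 (.orI₁ ψ.2 (.head φ.2))) (prin_le_prin.2 (.orI₂ φ.2 (.head ψ.2)))
  · refine le_of_le_prin fun χ hχ => prin_le_prin.2 ?_
    have h₁ := prin_le_prin.1 (le_sup_left.trans hχ)
    have h₂ := prin_le_prin.1 (le_sup_right.trans hχ)
    exact .orE (.head (.or φ.2 ψ.2))
      (.weakening (Set.insert_subset_insert (Set.subset_insert _ _)) h₁)
      (.weakening (Set.insert_subset_insert (Set.subset_insert _ _)) h₂)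

theorem prin_bot : prin ⟨.bot, .bot⟩ = (⊥ : S.Truth l Γ) :=
  le_bot_iff.1 (le_of_le_prin fun φ _ => prin_le_prin.2 (.botE φ.2 (.head .bot)))

theorem prin_eq_top {φ : S.Lindenbaum l Γ} : prin φ = ⊤ ↔ S.MSL l Γ φ.1 := by
  constructor
  · intro h
    -- Any provable formula would do on the left; it is then cut away.
    have h₁ : prin (l := l) (Γ := Γ) ⟨.imp .bot .bot, .imp .bot .bot⟩ ≤ prin φ := h ▸ le_top
    exact MSL.cut (.impI .bot (.head .bot)) (prin_le_prin.1 h₁)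
  · exact fun h => top_le_iff.1
      (le_of_prin_le fun χ _ => prin_le_prin.2 (.weakening (Set.subset_insert _ _) h))

/-- Double complement is monotone, so it suffices to treat the principal cuts above `a`. There
complements are negations of formulas, and the claim is RAA. -/
theorem compl_compl_le (hl : l = .classical) (a : S.Truth l Γ) : aᶜᶜ ≤ a := by
  refine le_of_le_prin fun φ hφ => (compl_le_compl (compl_le_compl hφ)).trans ?_
  rw [← himp_bot (prin φ), ← himp_bot, ← prin_bot, prin_himp_prin, prin_himp_prin, prin_le_prin]
  exact .raa hl φ.2 (.impE (.assumption (.imp (.imp φ.2 .bot) .bot) (by simp))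
    (.head (.imp φ.2 .bot)))

/-! ## The term model -/

theorem wellSorted_eq_iff {t u : S.lang.Term ℕ} :
    S.WellSorted (.eq t u) ↔ ∃ i, S.HasSort t i ∧ S.HasSort u i :=
  ⟨fun h => by cases h with | eq h₁ h₂ => exact ⟨_, h₁, h₂⟩, fun ⟨_, h₁, h₂⟩ => .eq h₁ h₂⟩

theorem wellSorted_rel_iff {n : ℕ} {R : S.lang.Relations n} {ts : Fin n → S.lang.Term ℕ} :
    S.WellSorted (.rel R ts) ↔ ∃ s ∈ S.rankRel R, ∀ k, S.HasSort (ts k) (s k) :=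
  ⟨fun h => by cases h with | rel h₁ h₂ => exact ⟨_, h₂, h₁⟩, fun ⟨_, h₁, h₂⟩ => .rel h₂ h₁⟩

open Classical in
/-- The truth value of a formula, which is `⊥` if the formula is not well-sorted. -/
noncomputable def value (l : Logic) (Γ : Set (Formula S.lang)) (φ : Formula S.lang) : S.Truth l Γ :=
  if h : S.WellSorted φ then prin ⟨φ, h⟩ else ⊥

theorem value_of_wellSorted {φ : Formula S.lang} (h : S.WellSorted φ) :
    value l Γ φ = prin ⟨φ, h⟩ := dif_pos h

theorem value_of_not {φ : Formula S.lang} (h : ¬ S.WellSorted φ) : value l Γ φ = ⊥ := dif_neg h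

theorem prin_le_value {φ : S.Lindenbaum l Γ} {ψ : Formula S.lang} (h : S.WellSorted ψ) :
    prin φ ≤ value l Γ ψ ↔ S.MSL l (insert φ.1 Γ) ψ := by
  rw [value_of_wellSorted h, prin_le_prin]

/-- The well-sorted terms. -/
@[ext]
structure STerm (S : Signature.{u, v, w}) where
  term : S.lang.Term ℕ
  hasSort : ∃ i, S.HasSort term i

theorem exists_sterm (S : Signature.{u, v, w}) (i : S.Sorts) :
    ∃ a : S.STerm, S.HasSort a.1 i := by
  obtain ⟨x, hx, _⟩ := S.exists_fresh i ∅
  exact ⟨⟨.var x, i, .var hx⟩, .var hx⟩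

instance : Nonempty S.STerm :=
  S.nonempty_sorts.elim fun i => (S.exists_sterm i).elim fun a _ => ⟨a⟩

open Classical in
/-- A term as an element of the term model; terms that are not well sorted are sent to a default
element. -/
noncomputable def toSTerm (t : S.lang.Term ℕ) : S.STerm :=
  if h : ∃ i, S.HasSort t i then ⟨t, h⟩ else Classical.arbitrary _

theorem toSTerm_val {t : S.lang.Term ℕ} {i : S.Sorts} (h : S.HasSort t i) : (toSTerm t).1 = t := by
  rw [toSTerm, dif_pos ⟨i, h⟩]

theorem toSTerm_of_not {t : S.lang.Term ℕ} (h : ¬ ∃ i, S.HasSort t i) :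
    toSTerm t = Classical.arbitrary S.STerm := dif_neg h

open Classical in
/-- The truth value of `Q_i a`. -/
noncomputable def sortVal (l : Logic) (Γ : Set (Formula S.lang)) (i : S.Sorts) (a : S.STerm) :
    S.Truth l Γ :=
  if S.HasSort a.1 i then ⊤ else ⊥

theorem sortVal_pos {i : S.Sorts} {a : S.STerm} (h : S.HasSort a.1 i) : sortVal l Γ i a = ⊤ :=
  if_pos h

theorem sortVal_neg {i : S.Sorts} {a : S.STerm} (h : ¬ S.HasSort a.1 i) : sortVal l Γ i a = ⊥ :=
  if_neg h

/-- The interpretation of the relation symbols in the term model. -/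
noncomputable def relVal (l : Logic) (Γ : Set (Formula S.lang)) :
    ∀ {n : ℕ}, S.lang.Relations n ⊕ S.SortPred n → (Fin n → S.STerm) → S.Truth l Γ
  | _, .inl R, a => value l Γ (.rel R fun k => (a k).1)
  | _, .inr (.Q i), a => sortVal l Γ i (a 0)

theorem value_eq_self (a : S.STerm) : value l Γ (.eq a.1 a.1) = ⊤ := by
  obtain ⟨i, hi⟩ := a.2
  rw [value_of_wellSorted (.eq hi hi), prin_eq_top]
  exact .eq_refl hi

theorem iInf_value_eq_bot {n : ℕ} {a b : Fin n → S.STerm}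
    (h : ¬ ∀ k, S.WellSorted (.eq (a k).1 (b k).1)) :
    ⨅ k, value l Γ (.eq (a k).1 (b k).1) = ⊥ := by
  push Not at h
  obtain ⟨k, hk⟩ := h
  exact le_bot_iff.1 ((iInf_le _ k).trans_eq (value_of_not hk))

theorem value_func_congr {n : ℕ} (f : S.lang.Functions n) (a b : Fin n → S.STerm) :
    ⨅ k, value l Γ (.eq (a k).1 (b k).1) ≤
      value l Γ (.eq (toSTerm (.func f fun k => (a k).1)).1 (toSTerm (.func f fun k => (b k).1)).1) := by
  by_cases h : ∀ k, S.WellSorted (.eq (a k).1 (b k).1)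
  · have h' := h
    simp only [wellSorted_eq_iff] at h'
    choose s ha hb using h'
    by_cases hf : ∃ i, S.rankFun f s = some i
    · obtain ⟨i, hi⟩ := hf
      rw [toSTerm_val (.func ha hi), toSTerm_val (.func hb hi)]
      refine le_of_prin_le fun χ hχ => ?_
      rw [prin_le_value (.eq (.func ha hi) (.func hb hi))]
      exact .func_congr hi ha hb fun k => (prin_le_value (h k)).1 (hχ.trans (iInf_le _ k))
    -- Both tuples have the sorts `s`, so both applications of `f` are ill sorted. They collapse to
    -- the same default element, and the equation between them has value `⊤`.
    · have key : ∀ c : Fin n → S.STerm, (∀ k, S.HasSort (c k).1 (s k)) →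
          ¬ ∃ i, S.HasSort (.func f fun k => (c k).1) i := by
        rintro c hc ⟨i, hi⟩
        obtain ⟨s', h₁, h₂⟩ := HasSort.func_iff.1 hi
        rw [funext fun k => (h₁ k).unique (hc k)] at h₂
        exact hf ⟨i, h₂⟩
      rw [toSTerm_of_not (key a ha), toSTerm_of_not (key b hb), value_eq_self]
      exact le_top
  · rw [iInf_value_eq_bot h]
    exact bot_le

theorem relVal_congr {n : ℕ} (R : S.lang.Relations n ⊕ S.SortPred n) (a b : Fin n → S.STerm) :
    (⨅ k, value l Γ (.eq (a k).1 (b k).1)) ⊓ relVal l Γ R a ≤ relVal l Γ R b := by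
  by_cases h : ∀ k, S.WellSorted (.eq (a k).1 (b k).1)
  · have h' := h
    simp only [wellSorted_eq_iff] at h'
    choose s ha hb using h'
    match n, R with
    | n, .inl R =>
      simp only [relVal]
      by_cases hR : S.WellSorted (.rel R fun k => (a k).1)
      · obtain ⟨s', hs', ha'⟩ := wellSorted_rel_iff.1 hR
        rw [funext fun k => (ha' k).unique (ha k)] at hs'
        refine le_of_prin_le fun χ hχ => ?_
        rw [prin_le_value (.rel hb hs')]
        exact .rel_congr hs' ha hb
          (fun k => (prin_le_value (h k)).1 ((hχ.trans inf_le_left).trans (iInf_le _ k)))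
          ((prin_le_value hR).1 (hχ.trans inf_le_right))
      · rw [value_of_not hR, inf_bot_eq]
        exact bot_le
    | _, .inr (.Q i) =>
      simp only [relVal]
      by_cases hi : S.HasSort (a 0).1 i
      -- A well-sorted equation has sides of equal sort, so the sort predicates respect it.
      · rw [sortVal_pos (a := b 0)]
        · exact le_top
        · rw [hi.unique (ha 0)]
          exact hb 0
      · rw [sortVal_neg hi, inf_bot_eq]
        exact bot_le
  · rw [iInf_value_eq_bot h, bot_inf_eq]
    exact bot_le

/-- The term model of `Γ`. -/
noncomputable def termModel (l : Logic) (Γ : Set (Formula S.lang)) :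
    HeytingModel S.starLang (S.Truth l Γ) S.STerm where
  func {n} (f : S.lang.Functions n) a := toSTerm (.func f fun k => (a k).1)
  rel {n} (R : S.lang.Relations n ⊕ S.SortPred n) a := relVal l Γ R a
  eq a b := value l Γ (.eq a.1 b.1)
  eq_refl := value_eq_self
  eq_symm a b := by
    by_cases h : S.WellSorted (.eq a.1 b.1)
    · obtain ⟨i, ha, hb⟩ := wellSorted_eq_iff.1 h
      refine le_of_prin_le fun χ hχ => ?_
      rw [prin_le_value (.eq hb ha)]
      exact .eq_symm ha hb ((prin_le_value h).1 hχ)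
    · rw [value_of_not h]
      exact bot_le
  eq_trans a b c := by
    by_cases h : S.WellSorted (.eq a.1 b.1)
    · by_cases h' : S.WellSorted (.eq b.1 c.1)
      · obtain ⟨i, ha, hb⟩ := wellSorted_eq_iff.1 h
        obtain ⟨j, hb', hc⟩ := wellSorted_eq_iff.1 h'
        obtain rfl := hb.unique hb'
        refine le_of_prin_le fun χ hχ => ?_
        rw [prin_le_value (.eq ha hc)]
        exact .eq_trans ha hb hc ((prin_le_value h).1 (hχ.trans inf_le_left))
          ((prin_le_value h').1 (hχ.trans inf_le_right))
      · rw [value_of_not h', inf_bot_eq]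
        exact bot_le
    · rw [value_of_not h, bot_inf_eq]
      exact bot_le
  func_congr := value_func_congr
  rel_congr := relVal_congr

theorem val_sortAtom (ρ : ℕ → S.STerm) (i : S.Sorts) (t : S.starLang.Term ℕ) :
    (termModel l Γ).val ρ (S.sortAtom i t) = sortVal l Γ i ((termModel l Γ).term ρ t) := rfl

theorem val_star_rel (ρ : ℕ → S.STerm) {n : ℕ} (R : S.lang.Relations n)
    (ts : Fin n → S.lang.Term ℕ) :
    (termModel l Γ).val ρ (S.star (.rel R ts)) =
      value l Γ (.rel R fun k => ((termModel l Γ).term ρ (S.starTerm (ts k))).1) := rfl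

theorem val_star_eq (ρ : ℕ → S.STerm) (t u : S.lang.Term ℕ) :
    (termModel l Γ).val ρ (S.star (.eq t u)) =
      value l Γ (.eq ((termModel l Γ).term ρ (S.starTerm t)).1
        ((termModel l Γ).term ρ (S.starTerm u)).1) := rfl

theorem term_starTerm_func (ρ : ℕ → S.STerm) {n : ℕ} (f : S.lang.Functions n)
    (ts : Fin n → S.lang.Term ℕ) :
    (termModel l Γ).term ρ (S.starTerm (.func f ts)) =
      toSTerm (.func f fun k => ((termModel l Γ).term ρ (S.starTerm (ts k))).1) := rfl

theorem val_sortAxiom {A : Formula S.starLang} (h : S.SortAxiom A) (ρ : ℕ → S.STerm) :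
    (termModel l Γ).val ρ A = ⊤ := by
  cases h with
  | nonempty i x =>
    obtain ⟨a, ha⟩ := S.exists_sterm i
    refine top_le_iff.1 (le_trans (le_of_eq ?_)
      (le_iSup (fun a : S.STerm => (termModel l Γ).val _ _) a))
    rw [val_sortAtom, sortVal_pos]
    simpa [HeytingModel.term] using ha
  | func f s i x hf =>
    rw [HeytingModel.val, himp_eq_top_iff, HeytingModel.val_conj_ofFn]
    simp only [val_sortAtom]
    by_cases h : ∀ k, S.HasSort (ρ (x k)).1 (s k)
    · rw [sortVal_pos (a := (termModel l Γ).term ρ _)]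
      · exact le_top
      · have hsort := HasSort.func (f := f) h hf
        rw [term_starTerm_func]
        change S.HasSort (toSTerm (.func f fun k => (ρ (x k)).1)).1 i
        rwa [toSTerm_val hsort]
    · push Not at h
      obtain ⟨k, hk⟩ := h
      exact (iInf_le _ k).trans ((sortVal_neg hk).trans_le bot_le)

/-- Disjointness is uniqueness of sorts; strictness holds because ill-sorted atoms were given the
value `⊥`; covering holds because the domain contains no terms without a sort. -/
theorem val_optionalSortAxiom {A : Formula S.starLang} (h : S.OptionalSortAxiom A)
    (ρ : ℕ → S.STerm) : (termModel l Γ).val ρ A = ⊤ := by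
  cases h with
  | disjoint i j x hij =>
    rw [HeytingModel.val, himp_eq_top_iff, neg, HeytingModel.val, HeytingModel.val, le_himp_iff,
      val_sortAtom, val_sortAtom]
    by_cases hi : S.HasSort (ρ x).1 i
    · by_cases hj : S.HasSort (ρ x).1 j
      · exact absurd (hi.unique hj) hij
      · exact inf_le_right.trans_eq (sortVal_neg hj)
    · exact inf_le_left.trans_eq (sortVal_neg hi)
  | strict R s x k hR =>
    rw [HeytingModel.val, himp_eq_top_iff, val_star_rel, val_sortAtom]
    by_cases h : S.WellSorted (.rel R fun k => (ρ (x k)).1)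
    · obtain ⟨s', hs', h'⟩ := wellSorted_rel_iff.1 h
      rw [hR, Set.mem_singleton_iff] at hs'
      subst hs'
      exact le_top.trans_eq (sortVal_pos (h' k)).symm
    · exact (value_of_not h).trans_le bot_le
  | cover is x _ his =>
    rw [HeytingModel.val_disj]
    obtain ⟨i, hi⟩ := (ρ x).2
    refine top_le_iff.1 (le_trans (sortVal_pos (l := l) (Γ := Γ) hi).symm.le ?_)
    exact le_iSup₂_of_le (S.sortAtom i (.var x)) (List.mem_map_of_mem (his i)) le_rfl

/-- The identical valuation. -/
noncomputable def idVal (x : ℕ) : S.STerm := toSTerm (.var x)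

theorem term_idVal {t : S.lang.Term ℕ} {i : S.Sorts} (h : S.HasSort t i) :
    (termModel l Γ).term idVal (S.starTerm t) = ⟨t, i, h⟩ := by
  apply STerm.ext
  induction h with
  | var h => exact toSTerm_val (.var h)
  | @func n f ts s i h hf ih =>
    rw [term_starTerm_func]
    have : (fun k => ((termModel l Γ).term idVal (S.starTerm (ts k))).1) = ts := funext ih
    rw [this]
    exact toSTerm_val (.func h hf)

/-! ### The quantifier cases of the truth lemma -/

section TruthLemma

variable {φ : Formula S.lang} (hφ : S.WellSorted φ)
  (ih : ∀ ψ (hψ : S.WellSorted ψ), ψ.size = φ.size →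
    (termModel l Γ).val idVal (S.star ψ) = prin ⟨ψ, hψ⟩)
  {x : ℕ} {i : S.Sorts} (hx : S.varSort x = some i)

include hφ ih hx

/-- Changing the identical valuation at `x` to `t` amounts to substituting `t` for `x`. The instance
is no subformula, which is why the induction hypothesis covers all formulas of the same size. -/
theorem val_update_eq_of_freeFor {t : S.lang.Term ℕ} (ht : S.HasSort t i) (hf : φ.FreeFor x t) :
    (termModel l Γ).val (Function.update idVal x ⟨t, i, ht⟩) (S.star φ) =
      prin ⟨φ.subst x t, hφ.subst hx ht⟩ := by
  rw [← ih (φ.subst x t) (hφ.subst hx ht) (size_subst _ _ _), star_subst,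
    HeytingModel.val_subst _ (freeFor_star hf), term_idVal ht]

/-- For an arbitrary term, capture is avoided by first passing to a variant of `φ` whose bound
variables are not in `t`. Variants keep the size, so the induction hypothesis still applies. -/
theorem exists_val_update_eq {t : S.lang.Term ℕ} (ht : S.HasSort t i) :
    ∃ (φ' : Formula S.lang) (hφ' : S.WellSorted φ'), S.MSL l {φ} φ' ∧ S.MSL l {φ'} φ ∧
      φ'.FreeFor x t ∧ (termModel l Γ).val (Function.update idVal x ⟨t, i, ht⟩) (S.star φ) =
        prin ⟨φ'.subst x t, hφ'.subst hx ht⟩ := by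
  obtain ⟨φ', h, hd⟩ := exists_variant (termModel l Γ) l hφ t.varFinset
  refine ⟨φ', h.1, h.3, h.4, freeFor_of_disjoint hd, ?_⟩
  rw [← h.5]
  exact val_update_eq_of_freeFor h.1 (fun ψ hψ hs => ih ψ hψ (hs.trans h.2)) hx ht
    (freeFor_of_disjoint hd)

theorem val_all (hΓ : ∀ ψ ∈ Γ, ψ.freeVars = ∅) :
    (termModel l Γ).val idVal (S.star (.all x φ)) = prin ⟨.all x φ, .all hx hφ⟩ := by
  rw [star_all hx]
  apply le_antisymm
  · refine le_of_prin_le fun χ hχ => ?_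
    -- If `χ` lies below all instances, it lies below the one at the fresh variable `y`. As `Γ`
    -- consists of sentences, `y` can be generalized and renamed back to `x`.
    obtain ⟨y, hy, hyV⟩ := S.exists_fresh i (χ.1.freeVars ∪ φ.freeVars ∪ φ.boundVars)
    simp only [Finset.mem_union, not_or] at hyV
    obtain ⟨⟨hyχ, hf⟩, hb⟩ := hyV
    have h := hχ.trans (iInf_le (fun a : S.STerm => (termModel l Γ).val _ _) ⟨.var y, i, .var hy⟩)
    rw [HeytingModel.val, val_sortAtom, sortVal_pos, top_himp,
      val_update_eq_of_freeFor hφ ih hx (.var hy) (freeFor_var hb), prin_le_prin] at h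
    · rw [prin_le_prin]
      refine MSL.trans (.allI hy ?_ h) (.all_rename_symm hx hy hf hb hφ)
      rintro ψ (rfl | hψ)
      · exact hyχ
      · simp [hΓ ψ hψ]
    · simpa [HeytingModel.term] using HasSort.var hy
  · refine le_iInf fun (a : S.STerm) => ?_
    rw [HeytingModel.val, val_sortAtom, le_himp_iff]
    -- For terms of another sort the guard has value `⊥` and the implication imposes nothing.
    by_cases ha : S.HasSort a.1 i
    · obtain ⟨φ', hφ', h₁, _, hff, hv⟩ := exists_val_update_eq hφ ih hx ha
      refine inf_le_left.trans (le_trans ?_ hv.ge)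
      rw [prin_le_prin]
      exact .allE hx ha hff (.trans (.head (.all hx hφ)) (.all_mono hx h₁ hφ))
    · rw [sortVal_neg, inf_bot_eq]
      · exact bot_le
      · simpa [HeytingModel.term] using ha

theorem val_ex (hΓ : ∀ ψ ∈ Γ, ψ.freeVars = ∅) :
    (termModel l Γ).val idVal (S.star (.ex x φ)) = prin ⟨.ex x φ, .ex hx hφ⟩ := by
  rw [star_ex hx]
  apply le_antisymm
  · refine iSup_le fun (a : S.STerm) => ?_
    rw [HeytingModel.val, val_sortAtom]
    by_cases ha : S.HasSort a.1 i
    · obtain ⟨φ', hφ', _, h₂, hff, hv⟩ := exists_val_update_eq hφ ih hx ha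
      refine inf_le_right.trans (hv.trans_le ?_)
      rw [prin_le_prin]
      exact .trans (.exI hx ha hff hφ' (.head (hφ'.subst hx ha))) (.ex_mono hx h₂ hφ')
    · rw [sortVal_neg, bot_inf_eq]
      · exact bot_le
      · simpa [HeytingModel.term] using ha
  -- Dually, a formula `χ` above the supremum is above the instance at a fresh variable, which is
  -- the minor premise of existential elimination.
  · refine le_of_le_prin fun χ hχ => ?_
    obtain ⟨y, hy, hyV⟩ := S.exists_fresh i (χ.1.freeVars ∪ φ.freeVars ∪ φ.boundVars)
    simp only [Finset.mem_union, not_or] at hyV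
    obtain ⟨⟨hyχ, hf⟩, hb⟩ := hyV
    have h := (le_iSup (fun a : S.STerm => (termModel l Γ).val _ _) ⟨.var y, i, .var hy⟩).trans hχ
    rw [HeytingModel.val, val_sortAtom, sortVal_pos, top_inf_eq,
      val_update_eq_of_freeFor hφ ih hx (.var hy) (freeFor_var hb), prin_le_prin] at h
    · rw [prin_le_prin]
      exact .exE (Set.subset_insert _ _) (fun ψ hψ => by simp [hΓ ψ hψ]) hyχ
        (.trans (.head (.ex hx hφ)) (.ex_rename hx hy hf hb hφ)) h
    · simpa [HeytingModel.term] using HasSort.var hy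

end TruthLemma

/-- In the term model, the value of the translation of `φ` is `φ` itself. -/
theorem val_star (hΓ : ∀ ψ ∈ Γ, ψ.freeVars = ∅) (φ : Formula S.lang) (hφ : S.WellSorted φ) :
    (termModel l Γ).val idVal (S.star φ) = prin ⟨φ, hφ⟩ := by
  induction hn : φ.size using Nat.strong_induction_on generalizing φ with
  | _ n ih =>
    subst hn
    cases hφ with
    | bot => exact prin_bot.symm
    | eq h₁ h₂ =>
      rw [val_star_eq, term_idVal h₁, term_idVal h₂, value_of_wellSorted (.eq h₁ h₂)]
    | rel h hR =>
      rw [val_star_rel]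
      simp only [term_idVal (h _)]
      exact value_of_wellSorted (.rel h hR)
    | and h₁ h₂ =>
      rw [star, HeytingModel.val, ih _ (by simp [size]) _ h₁ rfl,
        ih _ (by simp [size]) _ h₂ rfl, prin_inf_prin]
    | or h₁ h₂ =>
      rw [star, HeytingModel.val, ih _ (by simp [size]) _ h₁ rfl,
        ih _ (by simp [size]) _ h₂ rfl, prin_sup_prin]
    | imp h₁ h₂ =>
      rw [star, HeytingModel.val, ih _ (by simp [size]) _ h₁ rfl,
        ih _ (by simp [size]) _ h₂ rfl, prin_himp_prin]
    | all hx h => exact val_all h (fun ψ hψ hs => ih _ (by simp [size, hs]) ψ hψ rfl) hx hΓ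
    | ex hx h => exact val_ex h (fun ψ hψ hs => ih _ (by simp [size, hs]) ψ hψ rfl) hx hΓ

/-- Faithfulness of the translation. -/
theorem MSL.of_star (hΓ : ∀ ψ ∈ Γ, S.IsSentence ψ) {φ : Formula S.lang} (hφ : S.IsSentence φ)
    (h : FOL l (S.star '' Γ ∪ S.JPlus) (S.star φ)) : S.MSL l Γ φ := by
  have hs := (termModel l Γ).sound (fun hl => compl_compl_le hl) h idVal
  have hΓ' : ∀ ψ ∈ Γ, ψ.freeVars = ∅ := fun ψ hψ => (hΓ ψ hψ).2
  rw [val_star hΓ' φ hφ.1] at hs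
  refine (prin_eq_top (φ := ⟨φ, hφ.1⟩)).1 (top_le_iff.1 (le_trans ?_ hs))
  refine le_iInf₂ fun B hB => top_le_iff.2 ?_
  rcases hB with ⟨ψ, hψ, rfl⟩ | ⟨B, hB, rfl⟩ | ⟨B, hB, rfl⟩
  · rw [val_star hΓ' ψ (hΓ ψ hψ).1]
    exact prin_eq_top.2 (.assumption (hΓ ψ hψ).1 hψ)
  · exact HeytingModel.val_closure _ (val_sortAxiom hB) _
  · exact HeytingModel.val_closure _ (val_optionalSortAxiom hB) _

end Signature

/-! ### Derived rules of unsorted natural deduction -/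

namespace FOL

variable {L : FirstOrder.Language.{u, v}} {l : Logic} {P : Set (Formula L)} {A B C : Formula L}

theorem head : FOL l (insert A P) A := .assumption (Set.mem_insert _ _)

theorem cut (h : FOL l P A) (h' : FOL l (insert A P) B) : FOL l P B := .impE (.impI h') h

theorem allE_self {x : ℕ} (h : FOL l P (.all x A)) : FOL l P A := by
  simpa using h.allE (freeFor_self x A)

theorem conjI {As : List (Formula L)} (h : ∀ A ∈ As, FOL l P A) : FOL l P (conj As) := by
  induction As using conj.induct with
  | case1 => exact .impI head
  | case2 A => exact h A (by simp)
  | case3 A B As ih => exact .andI (h A (by simp)) (ih fun C hC => h C (by simp [List.mem_cons.1 hC]))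

/-- Eliminating a translated existential yields the single assumption `Q_i x ∧ φ*`; this splits it
into the sort hypothesis and the formula. -/
theorem of_and (h : FOL l (insert A (insert B P)) C) : FOL l (insert (.and A B) P) C := by
  refine cut (andE₂ head) (cut (A := A) (andE₁ (B := B) (.assumption (by simp))) (.weakening ?_ h))
  exact Set.insert_subset_insert (Set.insert_subset_insert (Set.subset_insert _ _))

end FOL

/-! ### Translating many-sorted derivations -/

namespace Signature

variable {S : Signature.{u, v, w}} {l : Logic}

theorem star_conj (As : List (Formula S.lang)) : S.star (conj As) = conj (As.map S.star) := by
  induction As using conj.induct with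
  | case1 => rfl
  | case2 A => rfl
  | case3 A B As ih => simp only [conj, star, List.map_cons] at ih ⊢; rw [ih]

theorem star_eqs {n : ℕ} (x y : Fin n → ℕ) : S.star (eqs x y) = eqs x y := by
  rw [eqs, star_conj, List.map_ofFn]
  rfl

theorem MSEqAxiom.star {φ : Formula S.lang} (h : S.MSEqAxiom φ) :
    EqAxiom S.starLang (S.star φ) := by
  cases h with
  | refl => exact .refl _
  | symm => exact .symm _ _
  | trans => exact .trans _ _ _
  | @rel n R s x y =>
    rw [Signature.star, star_eqs]
    exact EqAxiom.rel (L := S.starLang) (Sum.inl R) x y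
  | @func n f s i x y =>
    rw [Signature.star, star_eqs]
    exact EqAxiom.func (L := S.starLang) (S.starHom.onFunction f) x y

theorem star_foldr_all {φ : Formula S.lang} (h : FOL l ∅ (S.star φ)) (xs : List ℕ) :
    FOL l ∅ (S.star (xs.foldr all φ)) := by
  induction xs with
  | nil => exact h
  | cons x xs ih =>
    simp only [List.foldr_cons]
    cases hx : S.varSort x with
    | none => rw [star_all_none hx]; exact .allI (by simp) ih
    | some i =>
      rw [star_all hx]
      exact .allI (by simp) (.impI (.weakening (Set.empty_subset _) ih))

/-- The translated closure has guarded quantifiers, whereas the unsorted axiom has plain ones. So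
the plain prefix is stripped and the guarded one built up again, its guards being superfluous
antecedents. -/
theorem MSEqAxiom.star_closure {φ : Formula S.lang} (h : S.MSEqAxiom φ)
    (P : Set (Formula S.starLang)) : FOL l P (S.star φ.closure) :=
  .weakening (Set.empty_subset _) <| star_foldr_all
    (instantiate_self (ok := fun _ => True) (fun _ h => h.allE_self) (by simp) (.eqAxiom h.star)) _

/-- The sort of a well-sorted term is derivable from the sort axioms and the sorts of its
variables. -/
theorem HasSort.derivable {P : Set (Formula S.starLang)} (hP : S.J ⊆ P) {t : S.lang.Term ℕ}
    {i : S.Sorts} (ht : S.HasSort t i)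
    (hv : ∀ x ∈ t.varFinset, ∀ j, S.varSort x = some j → FOL l P (S.sortAtom j (.var x))) :
    FOL l P (S.sortAtom i (S.starTerm t)) := by
  induction ht with
  | var h => exact hv _ (by simp) _ h
  | @func n f ts s i _ hf ih =>
    -- The axiom of `J` for `f` is taken at distinct variables outside all arguments, so that it can
    -- be instantiated simultaneously by them.
    obtain ⟨x, hxi, hx, hxV⟩ :=
      S.exists_fresh_tuple s (Finset.univ.biUnion fun k => (ts k).varFinset)
    simp only [Finset.mem_biUnion, Finset.mem_univ, true_and, not_exists] at hxV
    let σ : ℕ → S.starLang.Term ℕ := Function.extend x (fun k => S.starTerm (ts k)) Term.var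
    have hσ : ∀ k, σ (x k) = S.starTerm (ts k) := fun k => hxi.extend_apply _ _ k
    let A := imp (conj (List.ofFn fun k => S.sortAtom (s k) (.var (x k))))
      (S.sortAtom i (S.starTerm (.func f fun k => .var (x k))))
    have hF : ∀ z ∈ A.freeVars, ∃ k, z = x k := by
      intro z hz
      simpa [A, freeVars, mem_freeVars_conj, List.mem_ofFn, mem_varFinset_func] using hz
    have hA : A.QuantifierFree := by
      refine ⟨quantifierFree_conj fun B hB => ?_, trivial⟩
      obtain ⟨k, rfl⟩ := (List.mem_ofFn' _ _).1 hB
      trivial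
    have h := instantiate_closure (Prov := FOL l P) (ok := fun _ _ => True) (σ := σ) (A := A)
      (fun _ hf h => h.allE hf) hA (by simp)
      (by
        intro z hz z' hz'
        obtain ⟨k, rfl⟩ := hF z hz
        obtain ⟨k', rfl⟩ := hF z' hz'
        rw [hσ, varFinset_starTerm]
        exact hxV k' k)
      (.assumption (hP ⟨A, .func f s i x hf, rfl⟩))
    have hs : A.substAll σ = imp (conj (List.ofFn fun k => S.sortAtom (s k) (S.starTerm (ts k))))
        (S.sortAtom i (S.starTerm (.func f ts))) := by
      simp only [A, substAll, substAll_conj, List.map_ofFn, sortAtom, starTerm_func,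
        starTerm_var, Term.subst, hσ]
      congr 3
      funext k
      simp [substAll, hσ]
    rw [hs] at h
    refine h.impE (FOL.conjI fun B hB => ?_)
    obtain ⟨k, rfl⟩ := (List.mem_ofFn' _ _).1 hB
    exact ih k fun z hz => hv z (mem_varFinset_func.2 ⟨k, hz⟩)

/-- The translations of the formulas in `Γ`, the sort axioms, and the hypotheses that the variables
in `V` have their sorts. -/
def sortContext (Γ : Set (Formula S.lang)) (V : Finset ℕ) : Set (Formula S.starLang) :=
  S.star '' Γ ∪ S.J ∪ {A | ∃ x ∈ V, ∃ i, S.varSort x = some i ∧ A = S.sortAtom i (.var x)}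

theorem insert_sortContext (φ : Formula S.lang) (Γ : Set (Formula S.lang)) (V : Finset ℕ) :
    insert (S.star φ) (sortContext Γ V) = sortContext (insert φ Γ) V := by
  simp only [sortContext, Set.image_insert_eq, Set.insert_union]

theorem sortContext_mono {Γ Γ' : Set (Formula S.lang)} (hΓ : Γ' ⊆ Γ) {V V' : Finset ℕ}
    (hV : V' ⊆ V) : sortContext Γ' V' ⊆ sortContext Γ V := by
  refine Set.union_subset_union (Set.union_subset_union_left _ (Set.image_mono hΓ)) ?_
  rintro A ⟨x, hx, h⟩
  exact ⟨x, hV hx, h⟩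

/-- The sort hypothesis on `x` is isolated because it would violate the eigenvariable condition for
`x`. The rest of the context, by the next lemma, satisfies it. -/
theorem sortContext_subset (Γ : Set (Formula S.lang)) (V : Finset ℕ) {x : ℕ} {i : S.Sorts}
    (hx : S.varSort x = some i) :
    sortContext Γ V ⊆ insert (S.sortAtom i (.var x)) (sortContext Γ (V.erase x)) := by
  rintro A (hA | ⟨y, hy, j, hj, rfl⟩)
  · exact .inr (.inl hA)
  · by_cases hyx : y = x
    · subst hyx
      rw [hx] at hj
      cases hj
      exact .inl rfl
    · exact .inr (.inr ⟨y, Finset.mem_erase.2 ⟨hyx, hy⟩, j, hj, rfl⟩)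

theorem notMem_freeVars_of_sortContext {Γ : Set (Formula S.lang)} {V : Finset ℕ} {x : ℕ}
    (hΓ : ∀ ψ ∈ Γ, x ∉ ψ.freeVars) : ∀ A ∈ sortContext Γ (V.erase x), x ∉ A.freeVars := by
  rintro A ((⟨ψ, hψ, rfl⟩ | ⟨B, _, rfl⟩) | ⟨y, hy, j, _, rfl⟩)
  · simpa using hΓ ψ hψ
  · simp
  · simpa using (Finset.ne_of_mem_erase hy).symm

theorem HasSort.derivable_sortContext {Γ : Set (Formula S.lang)} {V : Finset ℕ}
    {t : S.lang.Term ℕ} {i : S.Sorts} (ht : S.HasSort t i) (hV : t.varFinset ⊆ V) :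
    FOL l (sortContext Γ V) (S.sortAtom i (S.starTerm t)) :=
  ht.derivable (fun _ hA => .inl (.inr hA))
    fun x hx j hj => .assumption (.inr ⟨x, hV hx, j, hj, rfl⟩)

open Filter in
/-- Soundness of the translation, for formulas with free variables. -/
theorem MSL.eventually_star {Γ : Set (Formula S.lang)} {φ : Formula S.lang} (h : S.MSL l Γ φ) :
    ∀ᶠ V in atTop, FOL l (sortContext Γ V) (S.star φ) := by
  induction h with
  | assumption _ h => exact .of_forall fun V => .assumption (.inl (.inl ⟨_, h, rfl⟩))
  | weakening h _ ih => exact ih.mono fun V => .weakening (sortContext_mono h subset_rfl)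
  | eqAxiom h => exact .of_forall fun V => h.star_closure _
  | andI _ _ ih₁ ih₂ => filter_upwards [ih₁, ih₂] with V h₁ h₂ using .andI h₁ h₂
  | andE₁ _ ih => exact ih.mono fun V => .andE₁
  | andE₂ _ ih => exact ih.mono fun V => .andE₂
  | orI₁ _ _ ih => exact ih.mono fun V => .orI₁
  | orI₂ _ _ ih => exact ih.mono fun V => .orI₂
  | orE _ _ _ ih₁ ih₂ ih₃ =>
    filter_upwards [ih₁, ih₂, ih₃] with V h₁ h₂ h₃
    rw [← insert_sortContext] at h₂ h₃
    exact .orE h₁ h₂ h₃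
  | impI _ _ ih =>
    filter_upwards [ih] with V h
    rw [← insert_sortContext] at h
    exact .impI h
  | impE _ _ ih₁ ih₂ => filter_upwards [ih₁, ih₂] with V h₁ h₂ using .impE h₁ h₂
  | botE _ _ ih => exact ih.mono fun V => .botE
  | raa hl _ _ ih =>
    filter_upwards [ih] with V h
    rw [← insert_sortContext] at h
    exact .raa hl h
  | allI hx hΓ _ ih =>
    filter_upwards [ih] with V h
    rw [star_all hx]
    -- The sort hypothesis on `x` is discharged as the guard of the quantifier, and the remaining
    -- context does not mention `x` freely.
    exact .weakening (sortContext_mono subset_rfl (Finset.erase_subset _ V))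
      (.allI (notMem_freeVars_of_sortContext hΓ)
        (.impI (.weakening (sortContext_subset _ _ hx) h)))
  | @allE Γ φ x i t hx ht hf _ ih =>
    -- The set `V` must contain the variables of `t`, so that the guard `Q_i t` becomes derivable.
    filter_upwards [ih, eventually_ge_atTop t.varFinset] with V h hV
    rw [star_all hx] at h
    have := FOL.allE (A := .imp (S.sortAtom i (.var x)) (S.star φ)) (t := S.starTerm t)
      ⟨trivial, freeFor_star hf⟩ h
    rw [star_subst]
    refine .impE this ?_
    simpa [sortAtom, Formula.subst] using ht.derivable_sortContext hV
  | @exI Γ φ x i t hx ht hf _ _ ih =>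
    filter_upwards [ih, eventually_ge_atTop t.varFinset] with V h hV
    rw [star_ex hx]
    rw [star_subst] at h
    refine .exI (t := S.starTerm t) ⟨trivial, freeFor_star hf⟩ (.andI ?_ h)
    simpa [sortAtom, Formula.subst] using ht.derivable_sortContext hV
  | @exE Γ Γ' φ ψ x hΓ hx hψ h _ ih₁ ih₂ =>
    cases h.wellSorted with
    | ex hs _ =>
      filter_upwards [ih₁, ih₂] with V h₁ h₂
      rw [star_ex hs] at h₁
      rw [← insert_sortContext] at h₂
      -- The sort hypothesis on the eigenvariable is supplied by the guard in the existential
      -- premise.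
      refine .exE (sortContext_mono hΓ (Finset.erase_subset x V))
        (notMem_freeVars_of_sortContext hx) (by simpa using hψ) h₁ (.of_and (.weakening ?_ h₂))
      rw [Set.insert_comm]
      exact Set.insert_subset_insert (sortContext_subset _ _ hs)

/-- The sort hypotheses can be removed, as every sort is nonempty. -/
theorem fol_of_sortContext {Γ : Set (Formula S.lang)} (hΓ : ∀ ψ ∈ Γ, ψ.freeVars = ∅)
    {A : Formula S.starLang} (hA : A.freeVars = ∅) {V : Finset ℕ}
    (h : FOL l (sortContext Γ V) A) : FOL l (S.star '' Γ ∪ S.J) A := by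
  induction V using Finset.induction_on with
  | empty => simpa [sortContext] using h
  | insert x V hxV ih =>
    apply ih
    cases hx : S.varSort x with
    | none =>
      refine .weakening ?_ h
      rintro B (hB | ⟨y, hy, j, hj, rfl⟩)
      · exact .inl hB
      · rcases Finset.mem_insert.1 hy with rfl | hy
        · simp [hx] at hj
        · exact .inr ⟨y, hy, j, hj, rfl⟩
    | some i =>
      have hsub := sortContext_subset Γ (insert x V) hx
      rw [Finset.erase_insert hxV] at hsub
      have hfree := notMem_freeVars_of_sortContext (V := V) (x := x) (Γ := Γ)
        fun ψ hψ => by simp [hΓ ψ hψ]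
      rw [Finset.erase_eq_of_notMem hxV] at hfree
      -- The sort hypothesis on `x` is the assumption discharged when eliminating the axiom `∃ x,
      -- Q_i x`; nothing else in the context, nor `A`, has `x` free.
      refine .exE subset_rfl hfree (by simp [hA]) (.assumption (.inl (.inr ?_)))
        (.weakening hsub h)
      exact ⟨_, .nonempty i x, (closure_of_freeVars_eq_empty (by simp [freeVars])).symm⟩

/-- Soundness of the translation. -/
theorem MSL.star {Γ : Set (Formula S.lang)} (hΓ : ∀ ψ ∈ Γ, S.IsSentence ψ) {φ : Formula S.lang}
    (hφ : S.IsSentence φ) (h : S.MSL l Γ φ) : FOL l (S.star '' Γ ∪ S.JPlus) (S.star φ) := by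
  obtain ⟨V, hV⟩ := h.eventually_star.exists
  exact .weakening (Set.union_subset_union_right _ Set.subset_union_left)
    (fol_of_sortContext (fun ψ hψ => (hΓ ψ hψ).2) (by simpa using hφ.2) hV)

end Signature

end ManySorted

theorem theorem5p1 (l : ManySorted.Logic) (S : ManySorted.Signature)
    (Γ : Set (ManySorted.Formula S.lang)) (φ : ManySorted.Formula S.lang)
    (hΓ : ∀ ψ ∈ Γ, S.IsSentence ψ) (hφ : S.IsSentence φ) :
    S.MSL l Γ φ ↔ ManySorted.FOL l (S.star '' Γ ∪ S.JPlus) (S.star φ) :=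
  ⟨ManySorted.Signature.MSL.star hΓ hφ, .of_star hΓ hφ⟩
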